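/- **Conventions.** All spaces are Hausdorff. A space $X$ is of *Type I* if it is not Lindelöf and $X=\bigcup_{\xi<\omega_1}X_\xi$ with $X_\xi$ open, $\overline{X_\xi}$ Lindelöf, and $\overline{X_\xi}\subset X_\eta$ for $\xi<\eta$; a subset is *bounded* if it is contained in some $X_\xi$, and *club* if it is closed and unbounded. $\mathbb{L}_{\ge 0}$ is the closed long ray, i.e. $\omega_1\times[0,1)$ with the lexicographic order topology; $\omega_1\subset\mathbb{L}_{\ge0}$ via $\xi\mapsto\langle\xi,0\rangle$. For $A,B\subset X$ write $A\preceq B$ if every continuous $f:X\to\mathbb{L}_{\ge0}$ that is unbounded on $A$ is unbounded on $B$; $A,B$ are *ufo-equivalent* if $A\preceq B\preceq A$. A *direction* in $X$ is a club $D\subset X$ that is ufo-equivalent to each of its club subsets, and $\langle\mathfrak{D}_X,\preceq\rangle$ is the poset of ufo-equivalence classes of directions. A *surface* is a connected Hausdorff space in which each point has an open neighbourhood homeomorphic to $\mathbb{R}^2$ or to $\mathbb{R}\times[0,\infty)$ (so it may have a boundary). A space is *$\omega$-bounded* if the closure of each countable subset is compact. **Piles of octants.** For $a\in\omega_1$ let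 $\mathbb{O}_{\ge a}=\{\langle x,y\rangle\in\mathbb{L}_{\ge0}^2: a\le y\le x\}$. For an ordinal $\beta$ and an injective $h:\beta\to\omega_1$, let $S^{\beta,h}$ be the space obtained from a long ray $\Delta_0=\mathbb{L}_{\ge 0}$ by gluing successively, for $b<\beta$, a copy $O_b$ of $\mathbb{O}_{\ge h(b)}$ with its horizontal side $\{y=h(b)\}$ on the part at height $x\geq h(b)$ of the free upper side $\Delta_b$ of what was built before; the new free side $\Delta_{b+1}$ consists of the part of $\Delta_b$ at height $\le h(b)$ and of the diagonal side of $O_b$, and at limit stages $\gamma$ a free side $\Delta_\gamma$, to which the preceding octants converge, is added at those heights at which none is left. Explicitly, $S^{\beta,h}$ is the subspace of $\mathbb{L}_{\ge0}\times\mathbb{L}_{\ge0}^{\beta}$ of all $(x,u)$ such that $h(b)\le u_b\le\max(h(b),x)$ for all $b<\beta$, and $u_b=\max(h(b),x)$ whenever $b<c<\beta$ and $u_c>h(c)$; here $O_b$ is the set of points with $x\ge h(b)$, $u_c=\max(h(c),x)$ for $c<b$ and $u_c=h(c)$ for $c>b$; and, for $\gamma\le\beta$, $\Delta_\gamma$ is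 the set of points with $u_c=\max(h(c),x)$ for $c<\gamma$ and $u_c=h(c)$ for $c\ge\gamma$. The upper side of $S^{\beta,h}$ is $\Delta_\beta$. **Statement.** Let $\alpha$ be an ordinal with $0<\alpha<\omega_2$. 1. There is a Type I surface $S$ such that $\langle\mathfrak{D}_S,\preceq\rangle$ is order-isomorphic to $\alpha$. If $\alpha$ is a successor, $S$ can be taken $\omega$-bounded. 2. Let $\alpha=\beta+1$. For every injective $h:\beta\to\omega_1$, the space $S^{\beta,h}$ is of Type I and $\omega$-bounded, and $\langle\mathfrak{D}_{S^{\beta,h}},\preceq\rangle$ is order-isomorphic to $\alpha$. If moreover $h$ takes the value $0$, then $S^{\beta,h}$ is a surface. If $\beta\neq0$, there is an injective $h:\beta\to\omega_1$ that takes the value $0$. 3. Let $\alpha$ be a limit. There is an injective $h:\alpha\to\omega_1$, and for every such $h$ the space $S=S^{\alpha,h}\setminus\Delta_\alpha$ is a Type I surface with $\langle\mathfrak{D}_{S},\preceq\rangle$ order-isomorphic to $\alpha$. -/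

import Mathlib

open Set Topology Ordinal

noncomputable section

/-! ### The closed long ray -/

/-- The closed long ray `𝕃_{≥0}`: the set `ω₁ × [0, 1)` with the lexicographic order. -/
def LongRay : Type := (ω_ (1 : Ordinal.{0})).ToType ×ₗ Set.Ico (0 : ℝ) 1

instance : LinearOrder LongRay :=
  inferInstanceAs (LinearOrder ((ω_ (1 : Ordinal.{0})).ToType ×ₗ Set.Ico (0 : ℝ) 1))

/-- The long ray carries the order topology. -/
instance : TopologicalSpace LongRay := Preorder.topology LongRay

instance : OrderTopology LongRay := ⟨rfl⟩

/-- The countable ordinal `a`, seen as the point `⟨a, 0⟩` of the long ray. -/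
def LongRay.ofOrd (a : (ω_ (1 : Ordinal.{0})).ToType) : LongRay :=
  toLex (a, ⟨0, le_refl 0, one_pos⟩)

/-! ### Type I spaces, surfaces, `ω`-bounded spaces -/

section Spaces

variable (X : Type) [TopologicalSpace X]

/-- A sequence `⟨X_ξ : ξ < ω₁⟩` witnessing that `X` is of Type I: the `X_ξ` are open and cover `X`,
their closures are Lindelöf, and the closure of `X_ξ` is contained in `X_η` for `ξ < η`. -/
structure TypeISequence where
  /-- the member `X_ξ` of the sequence -/
  piece : (ω_ (1 : Ordinal.{0})).ToType → Set X
  isOpen_piece : ∀ i, IsOpen (piece i)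
  isLindelof_closure : ∀ i, IsLindelof (closure (piece i))
  closure_subset : ∀ i j, i < j → closure (piece i) ⊆ piece j
  iUnion_piece : ⋃ i, piece i = Set.univ

/-- `X` is a (non-Lindelöf) Type I space. -/
def IsTypeI : Prop := ¬ LindelofSpace X ∧ Nonempty (TypeISequence X)

/-- A surface, possibly with boundary: a connected Hausdorff space in which every point has an
open neighbourhood homeomorphic to the plane or to the closed half-plane. -/
def IsSurface : Prop :=
  T2Space X ∧ ConnectedSpace X ∧
    ∀ x : X, ∃ U : Set X, IsOpen U ∧ x ∈ U ∧
      (Nonempty (U ≃ₜ ℝ × ℝ) ∨ Nonempty (U ≃ₜ ℝ × Set.Ici (0 : ℝ)))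

/-- A space is `ω`-bounded if the closure of each countable subset is compact. -/
def IsOmegaBounded : Prop := ∀ A : Set X, A.Countable → IsCompact (closure A)

end Spaces

/-! ### The unbounded function order and directions -/

section Directions

variable {X : Type} [TopologicalSpace X]

/-- A subset of a Type I space is bounded if it is contained in some `X_ξ`. (In a Type I space this
does not depend on the sequence: any two sequences are cofinal in each other.) -/
def IsBoundedTypeI (A : Set X) : Prop := ∃ (s : TypeISequence X) (i : _), A ⊆ s.piece i

/-- Club subsets: closed and unbounded. -/
def IsClubSet (A : Set X) : Prop := IsClosed A ∧ ¬ IsBoundedTypeI A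

/-- The unbounded function order `A ≼ B`: every continuous `f : X → 𝕃_{≥0}` that is unbounded on `A`
is unbounded on `B`. -/
def UfoLE (A B : Set X) : Prop :=
  ∀ f : X → LongRay, Continuous f → ¬ BddAbove (f '' A) → ¬ BddAbove (f '' B)

variable (X) in
/-- A direction in `X` is a club subset that is ufo-equivalent to each of its club subsets. -/
structure Direction where
  /-- the underlying set of the direction -/
  carrier : Set X
  isClubSet : IsClubSet carrier
  equiv_of_subset : ∀ C : Set X, IsClubSet C → C ⊆ carrier → UfoLE C carrier ∧ UfoLE carrier C

instance : Preorder (Direction X) where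
  le D E := UfoLE D.carrier E.carrier
  le_refl _ := fun _ _ h => h
  le_trans _ _ _ h₁ h₂ := fun f hf h => h₂ f hf (h₁ f hf h)

variable (X) in
/-- The poset `⟨𝔇_X, ≼⟩` of ufo-equivalence classes of directions in `X`. -/
abbrev DirectionClass : Type := Antisymmetrization (Direction X) (· ≤ ·)

end Directions

/-! ### Piling up octants -/

/-- The octant `𝕆_{≥a} = {⟨x, y⟩ : a ≤ y ≤ x}`, with horizontal side `y = a` and diagonal side
`y = x`. -/
def Octant (a : LongRay) : Type := {q : LongRay × LongRay // a ≤ q.2 ∧ q.2 ≤ q.1}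

instance (a : LongRay) : TopologicalSpace (Octant a) := instTopologicalSpaceSubtype

variable {β : Ordinal.{0}}

/-- The space `S^{β,h}` obtained from a long ray `Δ_0` by piling up, for `b < β`, a copy `O_b` of the
octant `𝕆_{≥h(b)}`: the horizontal side of `O_b` is glued, at height `h(b)`, on the free upper side
`Δ_b` of what has been built before (all arrows are `↑`).

A point `p` is given by its height `x = p.1` and its coordinates `p.2 b`, `b < β`. If `p` lies in
`O_b`, then `p.2 b` is its second coordinate there; for the points below `O_b` in the pile `p.2 b`
has the minimal value `h(b)`, for the points above `O_b` the maximal value `x` (at heights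
`x < h(b)`, where `O_b` is absent, the coordinate is the constant `h(b)`). So, at height `x`, the
pile is the chain of the segments `[h(b), x]`, for the `b` with `h(b) < x`, put end to end in the
order of `b`, together with their limit points. For injective `h` only countably many coordinates
are not constant below a given height. The topology is that of pointwise convergence of the
coordinates. -/
def OctantPile (h : β.ToType → (ω_ (1 : Ordinal.{0})).ToType) : Type :=
  {p : LongRay × (β.ToType → LongRay) //
    (∀ b, LongRay.ofOrd (h b) ≤ p.2 b ∧ p.2 b ≤ max (LongRay.ofOrd (h b)) p.1) ∧
    ∀ b c, b < c → LongRay.ofOrd (h c) < p.2 c → p.2 b = max (LongRay.ofOrd (h b)) p.1}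

namespace OctantPile

variable (h : β.ToType → (ω_ (1 : Ordinal.{0})).ToType)

instance : TopologicalSpace (OctantPile h) := instTopologicalSpaceSubtype

instance : T2Space (OctantPile h) :=
  inferInstanceAs (T2Space (Subtype _))

/-- The copy `Δ_γ` of the long ray, parametrized by height: the free upper side once the octants
`O_b` with `b < γ` have been piled up. In particular `Δ_β` is the upper side of the whole pile. -/
def side (γ : Ordinal.{0}) (x : LongRay) : OctantPile h :=
  ⟨(x, fun b => open Classical in
      if (b : Ordinal) < γ then max (LongRay.ofOrd (h b)) x else LongRay.ofOrd (h b)), by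
    classical
    refine ⟨fun b => ?_, fun b c hbc hc => ?_⟩
    · by_cases hb : (b : Ordinal) < γ <;> simp [hb]
    · by_cases hcγ : (c : Ordinal) < γ
      · have hb : (b : Ordinal) < γ :=
          lt_trans (by simpa using hbc) hcγ
        simp [hb]
      · simp [hcγ] at hc⟩

/-- The inclusion of the octant `O_b`. -/
def octant (b : β.ToType) (q : Octant (LongRay.ofOrd (h b))) : OctantPile h :=
  ⟨(q.1.1, fun c => if c < b then max (LongRay.ofOrd (h c)) q.1.1 else
      if c = b then q.1.2 else LongRay.ofOrd (h c)), by
    refine ⟨fun c => ?_, fun c d hcd hd => ?_⟩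
    · by_cases hcb : c < b
      · simp [hcb]
      · by_cases hcb' : c = b
        · subst hcb'
          simpa using ⟨q.2.1, Or.inr q.2.2⟩
        · simp [hcb, hcb']
    · by_cases hdb : d < b
      · simp [hcd.trans hdb]
      · by_cases hdb' : d = b
        · subst hdb'
          simp [hcd]
        · simp [hdb, hdb'] at hd⟩

/-- The octant `O_b` is embedded as a closed subspace. -/
theorem isClosedEmbedding_octant (b : β.ToType) : IsClosedEmbedding (octant h b) := by
  let g : OctantPile h → Octant (LongRay.ofOrd (h b)) := fun p =>
    ⟨(max (LongRay.ofOrd (h b)) p.1.1, p.1.2 b), p.2.1 b⟩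
  have hg : Function.LeftInverse g (octant h b) := by
    intro q
    apply Subtype.ext
    have h1 : LongRay.ofOrd (h b) ≤ q.1.1 := q.2.1.trans q.2.2
    simp [g, octant, h1]
  have hgc : Continuous g := by
    refine Continuous.subtype_mk ?_ _
    have h1 : Continuous fun p : OctantPile h => p.1 := continuous_subtype_val
    exact (continuous_const.max h1.fst).prodMk ((continuous_apply b).comp h1.snd)
  have hoc : Continuous (octant h b) := by
    have h1 : Continuous fun q : Octant (LongRay.ofOrd (h b)) => q.1 := continuous_subtype_val
    refine Continuous.subtype_mk (h1.fst.prodMk (continuous_pi fun c => ?_)) _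
    split_ifs
    · exact continuous_const.max h1.fst
    · exact h1.snd
    · exact continuous_const
  exact hg.isClosedEmbedding hgc hoc

/-- The horizontal side of `O_b` lies on `Δ_b`. -/
theorem octant_horizontal (b : β.ToType) (x : LongRay) (hx : LongRay.ofOrd (h b) ≤ x) :
    octant h b ⟨(x, LongRay.ofOrd (h b)), le_refl _, hx⟩ = side h (b : Ordinal) x := by
  classical
  apply Subtype.ext
  refine Prod.ext rfl (funext fun c => ?_)
  by_cases hcb : c < b <;> simp +contextual [octant, side, hcb]

/-- The diagonal side of `O_b` lies on `Δ_{b+1}`. -/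
theorem octant_diagonal (b : β.ToType) (x : LongRay) (hx : LongRay.ofOrd (h b) ≤ x) :
    octant h b ⟨(x, x), hx, le_refl _⟩ = side h (Order.succ (b : Ordinal)) x := by
  classical
  apply Subtype.ext
  refine Prod.ext rfl (funext fun c => ?_)
  rcases lt_trichotomy c b with hcb | hcb | hcb
  · simp [octant, side, hcb, hcb.le]
  · subst hcb
    simp [octant, side, hx]
  · simp [octant, side, not_lt.2 hcb.le, hcb.ne', not_le.2 hcb]

/-- The pile with its upper side `Δ_β` removed. -/
abbrev WithoutTop : Type := {p : OctantPile h // p ∉ Set.range (side h β)}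

end OctantPile

end

noncomputable section

/-! ### Countable ordinals -/

/-! A continuous unbounded self-map of the long ray fixes club many countable ordinals. So along a
copy of the long ray on which the height is the parameter, a function is either bounded or equal to
the height at club many heights. This dichotomy holds uniformly over a separable connected family of
rays (`LongRay.bounded_or_eventually_fixed`), in particular on a strip `h b ≤ y ≤ η` of an octant:
every horizontal line of `O_b` behaves like `Δ_b`. A diagonal intersection over all `η` carries
equality with the height to the diagonal `Δ_{b+1}`, and convergence of the sides carries it through
limit stages. Hence unboundedness propagates upwards in the pile (`side_eventually_fixed_mono`). It
does not propagate downwards: the coordinate `b` is constant on `Δ_γ` for `γ ≤ b` and unbounded on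
`Δ_γ` for `γ > b`. The sides therefore form a chain ordered by their indices.

Each direction `D` is equivalent to a side. Let `c` be least such that `D` is unbounded in a region
where coordinate `c` is bounded. The coordinates before `c` escape along that part of `D`, so
compactness gives a club subset of `D` in a strip of `O_c`, and `D` is equivalent to `Δ_c`
(`exists_equiv_ray_of_strip`). If there is no such `c`, all coordinates escape and `D` has a club
subset on `Δ_β` (`equiv_ray_top`). If `Δ_β` has been removed, `D` instead contains a discrete family
of points at which a continuous function can be prescribed, unbounded on `D` but zero on a club
subset; this is absurd (`not_forall_bounded_of_notMem_top`).

Since `h` is injective, only countably many octants occur below a given height. Weighted sums of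
their coordinates embed that part of the pile into a quadrant (`nonempty_quadrantMap`), which yields
charts, connectedness and the Lindelöf property. An injective `h` exists because ordinals below `ω₂`
have cardinality at most `ℵ₁`. For `α = 1` the pile is only a long ray, so a long strip serves as
the surface. -/

/-- The well-ordered type of countable ordinals. -/
abbrev OmegaOne : Type := (ω_ (1 : Ordinal.{0})).ToType

namespace OmegaOne

theorem countable_Iio (a : OmegaOne) : (Iio a).Countable := by
  rw [← Cardinal.le_aleph0_iff_set_countable, ← Order.lt_succ_iff, Cardinal.succ_aleph0]
  simpa [Cardinal.mk_toType] using Cardinal.mk_Iio_lt a (by simp [Cardinal.mk_toType])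

theorem countable_Iic (a : OmegaOne) : (Iic a).Countable := by
  rw [← Iio_insert]
  exact (countable_Iio a).insert a

theorem not_countable_univ : ¬ (univ : Set OmegaOne).Countable := by
  rw [← Cardinal.le_aleph0_iff_set_countable]
  simp [Cardinal.mk_toType]

instance : Nonempty OmegaOne := by
  by_contra h
  rw [not_nonempty_iff] at h
  exact not_countable_univ countable_univ

instance : OrderBot OmegaOne :=
  WellFoundedLT.toOrderBot OmegaOne

theorem exists_gt_of_countable {A : Set OmegaOne} (hA : A.Countable) : ∃ b, ∀ a ∈ A, a < b := by
  by_contra! h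
  refine not_countable_univ ((hA.biUnion fun a _ => countable_Iic a).mono fun b _ => ?_)
  obtain ⟨a, ha, hba⟩ := h b
  exact mem_biUnion ha hba

instance : NoMaxOrder OmegaOne :=
  ⟨fun a => by simpa using exists_gt_of_countable (countable_singleton a)⟩

theorem exists_gt_range {ι : Type*} [Countable ι] (f : ι → OmegaOne) : ∃ b, ∀ i, f i < b := by
  simpa using exists_gt_of_countable (countable_range f)

end OmegaOne

/-! ### Sums over well-orders -/

theorem tsum_indicator_mono {ι : Type*} {w : ι → ℝ} (hw : ∀ i, 0 ≤ w i) (hs : Summable w) {A B : Set ι} (h : A ⊆ B) :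
    ∑' c, A.indicator w c ≤ ∑' c, B.indicator w c :=
  (hs.indicator A).tsum_le_tsum
    (fun c => indicator_le_indicator_of_subset h hw c) (hs.indicator B)

section WellOrderedSum

variable {ι : Type*} [LinearOrder ι] {w : ι → ℝ}

/-- A nonempty finite subset of `A` has a largest element `j`, and its sum is at most the full sum
over `Iic j`. -/
theorem tsum_indicator_le_of_forall_Iic (hw : ∀ i, 0 ≤ w i) (hs : Summable w) {t : ℝ}
    (ht : 0 ≤ t) {A : Set ι} (hA : ∀ j ∈ A, ∑' c, (Iic j).indicator w c ≤ t) :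
    ∑' c, A.indicator w c ≤ t := by
  classical
  refine (hs.indicator A).tsum_le_of_sum_le fun F => ?_
  rw [Finset.sum_indicator_eq_sum_filter]
  rcases (F.filter (· ∈ A)).eq_empty_or_nonempty with hF | hF
  · rw [hF]; simpa
  · set j := (F.filter (· ∈ A)).max' hF
    have hj : j ∈ F.filter (· ∈ A) := Finset.max'_mem _ _
    refine le_trans ?_ (hA j (Finset.mem_filter.1 hj).2)
    refine le_trans (Finset.sum_le_sum fun i hi => ?_) ((hs.indicator (Iic j)).sum_le_tsum
      (F.filter (· ∈ A)) fun i _ => indicator_nonneg (fun _ _ => hw _) _)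
    rw [indicator_of_mem (show i ∈ Iic j from Finset.le_max' _ _ hi)]

theorem tsum_indicator_Iic (hs : Summable w) (i : ι) :
    ∑' c, (Iic i).indicator w c = ∑' c, (Iio i).indicator w c + w i := by
  classical
  rw [← Iio_union_right, indicator_union_of_disjoint (by simp)]
  simp only []
  rw [Summable.tsum_add (hs.indicator _) (hs.indicator _)]
  congr 1
  rw [tsum_eq_single i]
  · simp
  · intro c hc
    simp [hc]

/-- The half-open intervals between consecutive partial sums cover everything below the sum. -/
theorem exists_partial_sum_le_lt [WellFoundedLT ι] (hw : ∀ i, 0 ≤ w i) (hs : Summable w) {t : ℝ}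
    (ht : 0 ≤ t) (ht' : t < ∑' c, w c) :
    ∃ i, ∑' c, (Iio i).indicator w c ≤ t ∧ t < ∑' c, (Iio i).indicator w c + w i := by
  have hne : {i | t < ∑' c, (Iic i).indicator w c}.Nonempty := by
    by_contra h
    have h' : ∀ i, ∑' c, (Iic i).indicator w c ≤ t := fun i => by
      by_contra hi
      exact h ⟨i, not_le.1 hi⟩
    have := tsum_indicator_le_of_forall_Iic hw hs ht (A := univ) fun j _ => h' j
    simp only [indicator_univ] at this
    exact absurd this (not_le.2 ht')
  -- The least index whose closed partial sum exceeds `t`; minimality bounds all earlier sums by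
  -- `t`, hence also their supremum, the open partial sum at `i`.
  set i := (wellFounded_lt (α := ι)).min _ hne
  have hmem : t < ∑' c, (Iic i).indicator w c := (wellFounded_lt (α := ι)).min_mem _ hne
  refine ⟨i, tsum_indicator_le_of_forall_Iic hw hs ht fun j hj => ?_, ?_⟩
  · by_contra hcon
    exact (wellFounded_lt (α := ι)).not_lt_min _ (not_le.1 hcon : t < _) hj
  · rwa [← tsum_indicator_Iic hs]

end WellOrderedSum

theorem Set.Countable.exists_summable_weight {ι : Type*} {A : Set ι} (hA : A.Countable) :
    ∃ w : ι → ℝ, (∀ i, 0 ≤ w i) ∧ (∀ i, 0 < w i ↔ i ∈ A) ∧ Summable w := by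
  classical
  obtain ⟨e, he, c, hc, -⟩ := hA.exists_pos_hasSum_le one_pos
  refine ⟨A.indicator e, fun i => indicator_nonneg (fun _ _ => (he _).le) _, fun i => ?_, ?_⟩
  · by_cases hi : i ∈ A <;> simp [hi, he]
  · exact summable_subtype_iff_indicator.1 hc.summable

/-! ### The long ray -/

namespace LongRay

/-- The point of the long ray with given coordinates. -/
def mk (a : OmegaOne) (r : Ico (0 : ℝ) 1) : LongRay := toLex (a, r)

/-- The ordinal part of a point. -/
def ord (x : LongRay) : OmegaOne := (ofLex x).1

/-- The fractional part of a point. -/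
def frac (x : LongRay) : ℝ := (ofLex x).2

theorem frac_nonneg (x : LongRay) : 0 ≤ x.frac := (ofLex x).2.2.1

theorem frac_lt_one (x : LongRay) : x.frac < 1 := (ofLex x).2.2.2

theorem lt_iff {x y : LongRay} : x < y ↔ x.ord < y.ord ∨ x.ord = y.ord ∧ x.frac < y.frac :=
  Prod.Lex.lt_iff

theorem ext {x y : LongRay} (h : x.ord = y.ord) (h' : x.frac = y.frac) : x = y := by
  have : (ofLex x) = ofLex y := Prod.ext h (Subtype.ext h')
  exact this

@[simp] theorem ord_ofOrd (a : OmegaOne) : (ofOrd a).ord = a := rfl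
@[simp] theorem frac_ofOrd (a : OmegaOne) : (ofOrd a).frac = 0 := rfl
@[simp] theorem ord_mk (a : OmegaOne) (r : Ico (0 : ℝ) 1) : (mk a r).ord = a := rfl
@[simp] theorem frac_mk (a : OmegaOne) (r : Ico (0 : ℝ) 1) : (mk a r).frac = r := rfl

theorem lt_ofOrd_iff {x : LongRay} {a : OmegaOne} : x < ofOrd a ↔ x.ord < a := by
  simp [lt_iff, not_lt.2 (frac_nonneg x)]

theorem ofOrd_le_iff {x : LongRay} {a : OmegaOne} : ofOrd a ≤ x ↔ a ≤ x.ord := by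
  rw [← not_lt, lt_ofOrd_iff, not_lt]

theorem strictMono_ofOrd : StrictMono ofOrd := fun _ _ h => lt_ofOrd_iff.2 h

@[simp] theorem ofOrd_lt_ofOrd {a b : OmegaOne} : ofOrd a < ofOrd b ↔ a < b :=
  strictMono_ofOrd.lt_iff_lt

@[simp] theorem ofOrd_le_ofOrd {a b : OmegaOne} : ofOrd a ≤ ofOrd b ↔ a ≤ b :=
  strictMono_ofOrd.le_iff_le

theorem exists_lt_ofOrd (x : LongRay) : ∃ a, x < ofOrd a := by
  obtain ⟨a, ha⟩ := exists_gt x.ord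
  exact ⟨a, lt_ofOrd_iff.2 ha⟩

instance : OrderBot LongRay where
  bot := ofOrd ⊥
  bot_le _ := ofOrd_le_iff.2 bot_le

instance : NoMaxOrder LongRay := ⟨fun x => by
  obtain ⟨a, ha⟩ := exists_lt_ofOrd x
  exact ⟨_, ha⟩⟩

theorem bddAbove_of_countable {A : Set LongRay} (hA : A.Countable) :
    ∃ a, ∀ x ∈ A, x < ofOrd a := by
  obtain ⟨b, hb⟩ := OmegaOne.exists_gt_of_countable (hA.image ord)
  exact ⟨b, fun x hx => lt_ofOrd_iff.2 (hb _ (mem_image_of_mem _ hx))⟩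

/-- Initial segments of the long ray are intervals. -/
theorem exists_real_chart (ξ : OmegaOne) : ∃ φ : LongRay → ℝ, Continuous φ ∧ Monotone φ ∧
    StrictMonoOn φ (Iic (ofOrd ξ)) ∧ (∀ x, φ x ∈ Icc 0 (φ (ofOrd ξ))) ∧
    φ '' Iic (ofOrd ξ) = Icc 0 (φ (ofOrd ξ)) := by
  classical
  -- Each of the countably many unit intervals `[a, a + 1)` with `a < ξ` is given length `w a`; the
  -- chart `φ` measures the length travelled and is constant beyond `ξ`.
  obtain ⟨w, hw, hpos, hs⟩ := (OmegaOne.countable_Iio ξ).exists_summable_weight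
  have hw0 : ∀ i, ξ ≤ i → w i = 0 := fun i hi =>
    le_antisymm (not_lt.1 fun h => absurd ((hpos i).1 h) (not_lt.2 hi)) (hw i)
  let P : OmegaOne → ℝ := fun i => ∑' c, (Iio i).indicator w c
  have hP : ∀ i, 0 ≤ P i := fun i => tsum_nonneg fun c => indicator_nonneg (fun _ _ => hw _) _
  have hPs : ∀ i j, i < j → P i + w i ≤ P j := fun i j hij => by
    rw [← tsum_indicator_Iic hs]
    exact tsum_indicator_mono hw hs (Iic_subset_Iio.2 hij)
  have hPξ : P ξ = ∑' c, w c := by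
    refine tsum_congr fun c => ?_
    by_cases hc : c < ξ
    · simp [hc]
    · simp [hc, hw0 c (not_lt.1 hc)]
  let φ : LongRay → ℝ := fun x => P x.ord + w x.ord * x.frac
  have hφord : ∀ a, φ (ofOrd a) = P a := fun a => by simp [φ]
  have hlt : ∀ x y : LongRay, x < y → φ x ≤ φ y ∧ (0 < w x.ord → φ x < φ y) := by
    intro x y hxy
    rcases lt_iff.1 hxy with h | ⟨h, h'⟩
    · have h1 := hPs _ _ h
      have h2 : 0 ≤ w y.ord * y.frac := mul_nonneg (hw _) (frac_nonneg y)
      have h3 := frac_lt_one x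
      have h4 := hw x.ord
      constructor
      · simp only [φ]; nlinarith
      · intro h5; simp only [φ]; nlinarith
    · simp only [φ, ← h]
      exact ⟨by have := hw x.ord; nlinarith, fun _ => by nlinarith⟩
  have hmono : Monotone φ := fun x y hxy => by
    rcases hxy.eq_or_lt with rfl | h
    · exact le_rfl
    · exact (hlt x y h).1
  have hstrict : StrictMonoOn φ (Iic (ofOrd ξ)) := fun x _ y hy hxy =>
    (hlt x y hxy).2 ((hpos _).2 (lt_ofOrd_iff.1 (hxy.trans_le hy)))
  have hsurj : ∀ t, 0 ≤ t → t < P ξ → ∃ x, x < ofOrd ξ ∧ φ x = t := by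
    intro t ht ht'
    rw [hPξ] at ht'
    obtain ⟨i, hi, hi'⟩ := exists_partial_sum_le_lt hw hs ht ht'
    have hwi : 0 < w i := by
      change P i ≤ t at hi
      change t < P i + w i at hi'
      linarith
    refine ⟨mk i ⟨(t - P i) / w i, div_nonneg (sub_nonneg.2 hi) hwi.le, ?_⟩,
      lt_ofOrd_iff.2 ((hpos i).1 hwi), ?_⟩
    · rw [div_lt_one hwi]
      exact sub_lt_iff_lt_add'.2 hi'
    · simp only [φ, ord_mk, frac_mk]
      field_simp
      ring
  have hle : ∀ x, φ x ≤ P ξ := fun x => by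
    rcases le_total x (ofOrd ξ) with h | h
    · rw [← hφord]; exact hmono h
    · have h1 : ξ ≤ x.ord := ofOrd_le_iff.1 h
      simp only [φ, hw0 _ h1, zero_mul, add_zero]
      rw [hPξ, ← indicator_univ w]
      exact tsum_indicator_mono hw hs (subset_univ _)
  have h0 : ∀ x, 0 ≤ φ x := fun x =>
    add_nonneg (hP _) (mul_nonneg (hw _) (frac_nonneg x))
  have himg : φ '' Iic (ofOrd ξ) = Icc 0 (φ (ofOrd ξ)) := by
    rw [hφord]
    refine subset_antisymm (image_subset_iff.2 fun x _ => ⟨h0 x, hle x⟩) fun t ht => ?_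
    rcases ht.2.eq_or_lt with rfl | h
    · exact ⟨ofOrd ξ, self_mem_Iic, hφord ξ⟩
    · obtain ⟨x, hx, rfl⟩ := hsurj t ht.1 h
      exact ⟨x, hx.le, rfl⟩
  refine ⟨φ, ?_, hmono, hstrict, fun x => ⟨h0 x, (hle x).trans_eq (hφord ξ).symm⟩, himg⟩
  -- A monotone surjection onto an interval is automatically continuous.
  let g : LongRay → Icc (0 : ℝ) (φ (ofOrd ξ)) := fun x => ⟨φ x, h0 x, by rw [hφord]; exact hle x⟩
  have : Continuous g := Monotone.continuous_of_surjective (fun x y h => hmono h) fun t => by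
    obtain ⟨x, -, hx⟩ := himg.symm.subset t.2
    exact ⟨x, Subtype.ext hx⟩
  exact continuous_subtype_val.comp this

/-- Initial segments of the long ray are continuous images of intervals. -/
theorem exists_parametrization (ξ : OmegaOne) : ∃ (T : ℝ) (ψ : Icc (0 : ℝ) T → LongRay),
    Continuous ψ ∧ StrictMono ψ ∧ range ψ = Iic (ofOrd ξ) := by
  obtain ⟨φ, hc, -, hs, -, himg⟩ := exists_real_chart ξ
  have hbij : Function.Bijective
      (fun x : Iic (ofOrd ξ) => (⟨φ x, himg.subset (mem_image_of_mem _ x.2)⟩ :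
        Icc (0 : ℝ) (φ (ofOrd ξ)))) := by
    constructor
    · intro x y hxy
      exact Subtype.ext (hs.injOn x.2 y.2 (congrArg Subtype.val hxy))
    · rintro ⟨t, ht⟩
      obtain ⟨x, hx, rfl⟩ := himg.symm.subset ht
      exact ⟨⟨x, hx⟩, rfl⟩
  let E : Iic (ofOrd ξ) ≃o Icc (0 : ℝ) (φ (ofOrd ξ)) :=
    StrictMono.orderIsoOfSurjective _ (fun x y h => hs x.2 y.2 h) hbij.2
  refine ⟨_, fun t => (E.symm t : LongRay), continuous_subtype_val.comp E.symm.continuous,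
    fun s t h => E.symm.strictMono h, ?_⟩
  ext x
  constructor
  · rintro ⟨t, rfl⟩
    exact (E.symm t).2
  · intro hx
    exact ⟨E ⟨x, hx⟩, by simp⟩

theorem isCompact_Iic (x : LongRay) : IsCompact (Iic x) := by
  obtain ⟨a, ha⟩ := exists_lt_ofOrd x
  obtain ⟨T, ψ, hψ, -, hr⟩ := exists_parametrization a
  exact (hr ▸ isCompact_range hψ).of_isClosed_subset isClosed_Iic (Iic_subset_Iic.2 ha.le)

/-- This transfers connectedness and separability from real intervals to bounded intervals of the
long ray. -/
theorem exists_surjective_Icc {x y : LongRay} (h : x ≤ y) : ∃ (a b : ℝ) (_ : a ≤ b)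
    (ψ : Icc a b → Icc x y), Continuous ψ ∧ Function.Surjective ψ := by
  obtain ⟨ξ, hξ⟩ := exists_lt_ofOrd y
  obtain ⟨T, ψ, hψ, hmono, hr⟩ := exists_parametrization ξ
  obtain ⟨a, rfl⟩ : x ∈ range ψ := hr ▸ h.trans hξ.le
  obtain ⟨b, rfl⟩ : y ∈ range ψ := hr ▸ hξ.le
  refine ⟨a, b, hmono.le_iff_le.1 h, fun t => ⟨ψ ⟨t, a.2.1.trans t.2.1, t.2.2.trans b.2.2⟩,
    hmono.monotone t.2.1, hmono.monotone t.2.2⟩, by fun_prop, ?_⟩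
  rintro ⟨z, hz⟩
  obtain ⟨c, rfl⟩ : z ∈ range ψ := hr ▸ hz.2.trans hξ.le
  exact ⟨⟨c, hmono.le_iff_le.1 hz.1, hmono.le_iff_le.1 hz.2⟩, rfl⟩

theorem preconnectedSpace_Icc {x y : LongRay} (h : x ≤ y) : PreconnectedSpace (Icc x y) := by
  obtain ⟨a, b, hab, ψ, hψ, hs⟩ := exists_surjective_Icc h
  have : PreconnectedSpace (Icc a b) := Subtype.preconnectedSpace isPreconnected_Icc
  exact hs.denseRange.preconnectedSpace hψ

theorem separableSpace_Icc {x y : LongRay} (h : x ≤ y) : TopologicalSpace.SeparableSpace (Icc x y) := by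
  obtain ⟨a, b, hab, ψ, hψ, hs⟩ := exists_surjective_Icc h
  exact hs.denseRange.separableSpace hψ

/-- Any two points of the long ray are joined by a path. -/
theorem exists_path (y : LongRay) : ∃ γ : unitInterval → LongRay, Continuous γ ∧ γ 0 = ⊥ ∧
    γ 1 = y := by
  obtain ⟨ξ, hξ⟩ := exists_lt_ofOrd y
  obtain ⟨T, ψ, hψ, hmono, hr⟩ := exists_parametrization ξ
  obtain ⟨a, ha⟩ : ⊥ ∈ range ψ := hr ▸ mem_Iic.2 bot_le
  obtain ⟨b, hb⟩ : y ∈ range ψ := hr ▸ hξ.le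
  have hmem : ∀ t : unitInterval, (1 - (t : ℝ)) * a + t * b ∈ Icc 0 T := fun t => by
    have h1 := t.2.1
    have h2 : 0 ≤ 1 - (t : ℝ) := sub_nonneg.2 t.2.2
    have ha1 := a.2.1
    have ha2 := a.2.2
    have hb1 := b.2.1
    have hb2 := b.2.2
    constructor
    · positivity
    · nlinarith
  exact ⟨fun t => ψ ⟨(1 - t) * a + t * b, hmem t⟩, hψ.comp (Continuous.subtype_mk (by fun_prop) _),
    by simp [ha], by simp [hb]⟩

theorem bddAbove_of_isLindelof {A : Set LongRay} (hA : IsLindelof A) : BddAbove A := by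
  obtain ⟨t, ht, hAt⟩ := hA.elim_countable_subcover (fun a : OmegaOne => Iio (ofOrd a))
    (fun _ => isOpen_Iio) fun x _ => mem_iUnion.2 (exists_lt_ofOrd x)
  obtain ⟨b, hb⟩ := OmegaOne.exists_gt_of_countable ht
  refine ⟨ofOrd b, fun x hx => ?_⟩
  obtain ⟨a, ha, hxa⟩ := mem_iUnion₂.1 (hAt hx)
  exact (hxa.trans (ofOrd_lt_ofOrd.2 (hb a ha))).le

theorem not_bddAbove_iff {A : Set LongRay} : ¬ BddAbove A ↔ ∀ a, ∃ x ∈ A, ofOrd a < x := by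
  rw [_root_.not_bddAbove_iff]
  refine ⟨fun h a => h _, fun h x => ?_⟩
  obtain ⟨a, ha⟩ := exists_lt_ofOrd x
  obtain ⟨y, hy, hay⟩ := h a
  exact ⟨y, hy, ha.trans hay⟩

end LongRay

/-! ### Club sets of countable ordinals -/

/-- The filter generated by the club subsets of `ω₁`. -/
def club : Filter OmegaOne where
  -- The closure points of functions `g` serve as a base of the filter, which avoids speaking of
  -- closed sets of ordinals.
  sets := {s | ∃ g : OmegaOne → OmegaOne, ∀ x, ⊥ < x → (∀ ζ < x, g ζ < x) → x ∈ s}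
  univ_sets := ⟨id, fun _ _ _ => trivial⟩
  sets_of_superset := fun ⟨g, hg⟩ hst => ⟨g, fun x hx h => hst (hg x hx h)⟩
  inter_sets := fun ⟨g, hg⟩ ⟨g', hg'⟩ => ⟨fun ζ => max (g ζ) (g' ζ), fun x hx h =>
    ⟨hg x hx fun ζ hζ => (le_max_left _ _).trans_lt (h ζ hζ),
      hg' x hx fun ζ hζ => (le_max_right _ _).trans_lt (h ζ hζ)⟩⟩

theorem eventually_club {P : OmegaOne → Prop} : (∀ᶠ x in club, P x) ↔
    ∃ g : OmegaOne → OmegaOne, ∀ x, ⊥ < x → (∀ ζ < x, g ζ < x) → P x := Iff.rfl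

theorem eventually_club_closed (g : OmegaOne → OmegaOne) : ∀ᶠ x in club, ∀ ζ < x, g ζ < x :=
  eventually_club.2 ⟨g, fun _ _ h => h⟩

theorem eventually_club_gt (a : OmegaOne) : ∀ᶠ x in club, a < x :=
  eventually_club.2 ⟨fun _ => a, fun _ hx h => h _ hx⟩

/-- Club sets are closed under diagonal intersections. -/
theorem eventually_club_diagonal {ι : Type*} {r : ι → OmegaOne}
    (hr : ∀ a, (r ⁻¹' {a}).Countable) {P : ι → OmegaOne → Prop}
    (hP : ∀ i, ∀ᶠ x in club, P i x) : ∀ᶠ x in club, ∀ i, r i < x → P i x := by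
  choose g hg using fun i => eventually_club.1 (hP i)
  have hc : ∀ a, (r ⁻¹' Iic a).Countable := fun a => by
    rw [← biUnion_of_singleton (Iic a), preimage_iUnion₂]
    exact (OmegaOne.countable_Iic a).biUnion fun b _ => hr b
  -- One function `G` dominates at `ζ` the countably many values `g i ζ'` with `r i ≤ ζ` and `ζ' ≤
  -- ζ`. A closure point `x` of `G` is then closed under `g i` whenever `r i < x`.
  have hG : ∀ ζ, ∃ b, ∀ i, r i ≤ ζ → ∀ ζ' ≤ ζ, g i ζ' < b := fun ζ => by
    have h1 : ((fun p : ι × OmegaOne => g p.1 p.2) '' ((r ⁻¹' Iic ζ) ×ˢ Iic ζ)).Countable :=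
      ((hc ζ).prod (OmegaOne.countable_Iic ζ)).image _
    obtain ⟨b, hb⟩ := OmegaOne.exists_gt_of_countable h1
    exact ⟨b, fun i hi ζ' hζ' => hb _ ⟨(i, ζ'), ⟨hi, hζ'⟩, rfl⟩⟩
  choose G hG using hG
  refine eventually_club.2 ⟨G, fun x hx h i hi => hg i x hx fun ζ hζ => ?_⟩
  exact (hG (max (r i) ζ) i (le_max_left _ _) ζ (le_max_right _ _)).trans
    (h _ (max_lt hi hζ))

theorem eventually_club_forall {ι : Type*} {S : Set ι} (hS : S.Countable)
    {P : ι → OmegaOne → Prop} (hP : ∀ i ∈ S, ∀ᶠ x in club, P i x) :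
    ∀ᶠ x in club, ∀ i ∈ S, P i x := by
  have := hS.to_subtype
  -- With constant rank `⊥`, a diagonal intersection is an ordinary countable intersection.
  filter_upwards [eventually_club_diagonal (r := fun _ : S => ⊥) (fun a => to_countable _)
    (fun i : S => hP i i.2), eventually_club_gt ⊥] with x hx h0 i hi
  exact hx ⟨i, hi⟩ h0

/-- Iterating a step that exceeds all earlier values of `g` and taking the supremum of the resulting
`ω`-sequence produces a closure point of `g` above `a`. -/
theorem Filter.Eventually.exists_gt_of_club {P : OmegaOne → Prop} (h : ∀ᶠ x in club, P x)
    (a : OmegaOne) : ∃ x, a < x ∧ P x := by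
  obtain ⟨g, hg⟩ := eventually_club.1 h
  have hstep : ∀ b, ∃ c, b < c ∧ ∀ ζ ≤ b, g ζ < c := fun b => by
    obtain ⟨c, hc⟩ := OmegaOne.exists_gt_of_countable
      (((OmegaOne.countable_Iic b).image g).insert b)
    exact ⟨c, hc b (mem_insert _ _), fun ζ hζ =>
      hc _ (mem_insert_of_mem _ (mem_image_of_mem _ hζ))⟩
  choose s hs hs' using hstep
  let u : ℕ → OmegaOne := fun n => s^[n] a
  have hu : ∀ n, u (n + 1) = s (u n) := fun n => Function.iterate_succ_apply' _ _ _
  have hne : {b | ∀ n, u n < b}.Nonempty := OmegaOne.exists_gt_range u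
  let x := (wellFounded_lt (α := OmegaOne)).min _ hne
  have hx : ∀ n, u n < x := (wellFounded_lt (α := OmegaOne)).min_mem _ hne
  refine ⟨x, hx 0, hg x (bot_le.trans_lt (hx 0)) fun ζ hζ => ?_⟩
  have : ∃ n, ζ ≤ u n := by
    by_contra! hcon
    exact (wellFounded_lt (α := OmegaOne)).not_lt_min _ (show ζ ∈ {b | ∀ n, u n < b} from hcon) hζ
  obtain ⟨n, hn⟩ := this
  exact (hs' (u n) ζ hn).trans (hu n ▸ hx (n + 1))

/-- Club many countable ordinals are limits. -/
theorem eventually_club_limit : ∀ᶠ x in club, ∀ y < LongRay.ofOrd x, ∃ ζ < x,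
    y < LongRay.ofOrd ζ := by
  choose g hg using fun a : OmegaOne => exists_gt a
  filter_upwards [eventually_club_closed g] with x hx y hy
  exact ⟨g y.ord, hx _ (LongRay.lt_ofOrd_iff.1 hy), LongRay.lt_ofOrd_iff.2 (hg _)⟩

namespace LongRay

/-- Closed unbounded subsets of the long ray contain club many countable ordinals. -/
theorem eventually_ofOrd_mem {C : Set LongRay} (hC : IsClosed C) (hC' : ¬ BddAbove C) :
    ∀ᶠ x in club, ofOrd x ∈ C := by
  rw [not_bddAbove_iff] at hC'
  choose z hz hz' using hC'
  choose g hg using fun a => exists_lt_ofOrd (z a)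
  filter_upwards [eventually_club_closed g, eventually_club_limit, eventually_club_gt ⊥]
    with x hx hlim h0
  rw [← hC.closure_eq, mem_closure_iff_nhds]
  intro U hU
  obtain ⟨l, hl, hlU⟩ := exists_Ioc_subset_of_mem_nhds hU ⟨ofOrd ⊥, ofOrd_lt_ofOrd.2 h0⟩
  obtain ⟨ζ, hζ, hlζ⟩ := hlim l hl
  exact ⟨z ζ, hlU ⟨hlζ.trans (hz' ζ), ((hg ζ).trans (ofOrd_lt_ofOrd.2 (hx ζ hζ))).le⟩, hz ζ⟩

/-- A continuous unbounded function on the long ray has club many fixed points. -/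
theorem eventually_fixed {f : LongRay → LongRay} (hf : Continuous f)
    (hf' : ¬ BddAbove (range f)) : ∀ᶠ x in club, f (ofOrd x) = ofOrd x := by
  have hbd : ∀ a, ∃ b, ∀ y ≤ ofOrd a, f y < ofOrd b := fun a => by
    obtain ⟨m, hm⟩ := ((isCompact_Iic (ofOrd a)).image hf).bddAbove
    obtain ⟨b, hb⟩ := exists_lt_ofOrd m
    exact ⟨b, fun y hy => (hm (mem_image_of_mem _ hy)).trans_lt hb⟩
  choose g hg using hbd
  -- A value above `g a` can only be taken beyond `a`, so a point `z > a` with `f z > a` exists.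
  have hub : ∀ a, ∃ b, ∃ z, ofOrd a < z ∧ z < ofOrd b ∧ ofOrd a < f z := fun a => by
    obtain ⟨_, ⟨z, rfl⟩, hz⟩ := not_bddAbove_iff.1 hf' (max a (g a))
    obtain ⟨b, hb⟩ := exists_lt_ofOrd z
    refine ⟨b, z, ?_, hb, (ofOrd_le_ofOrd.2 (le_max_left _ _)).trans_lt hz⟩
    by_contra hcon
    exact absurd (hz.trans (hg a z (not_lt.1 hcon))) (not_lt.2 (ofOrd_le_ofOrd.2 (le_max_right _ _)))
  choose g' z hz hz' hfz using hub
  filter_upwards [eventually_club_closed g, eventually_club_closed g', eventually_club_limit,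
    eventually_club_gt ⊥] with x hx hx' hlim h0
  -- The points `z ζ`, `ζ < x`, converge to `x`. Along them `f` stays below `x`, by closure under
  -- `g` and `g'`, and exceeds `ζ`; continuity then forces `f x = x`.
  have hcl : ∀ U ∈ 𝓝 (f (ofOrd x)), ∀ a < x, ∃ ζ, a ≤ ζ ∧ ζ < x ∧ f (z ζ) ∈ U := by
    intro U hU a ha
    obtain ⟨l, hl, hlU⟩ := exists_Ioc_subset_of_mem_nhds (hf.continuousAt hU)
      ⟨ofOrd ⊥, ofOrd_lt_ofOrd.2 h0⟩
    obtain ⟨ζ, hζ, hlζ⟩ := hlim l hl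
    have hm : max a ζ < x := max_lt ha hζ
    exact ⟨max a ζ, le_max_left _ _, hm, hlU ⟨(hlζ.trans_le (ofOrd_le_ofOrd.2
      (le_max_right _ _))).trans (hz _), ((hz' _).trans (ofOrd_lt_ofOrd.2 (hx' _ hm))).le⟩⟩
  refine le_antisymm (not_lt.1 fun hlt => ?_) (not_lt.1 fun hlt => ?_)
  · obtain ⟨ζ, -, hζ, hU⟩ := hcl _ (Ioi_mem_nhds hlt) ⊥ h0
    have h1 := hg (g' ζ) (z ζ) (hz' ζ).le
    exact absurd (hU.trans h1) (not_lt.2 (ofOrd_le_ofOrd.2 (hx _ (hx' _ hζ)).le))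
  · obtain ⟨a, ha, hfa⟩ := hlim _ hlt
    obtain ⟨ζ, haζ, -, hU⟩ := hcl _ (Iio_mem_nhds hfa) a ha
    exact absurd (hU.trans_le (ofOrd_le_ofOrd.2 haζ)) (not_lt.2 (hfz ζ).le)

/-- A family of functions on the long ray parametrized by a separable connected space is either
bounded, or club many countable ordinals are fixed by all members. -/
theorem bounded_or_eventually_fixed {K : Type*} [TopologicalSpace K]
    [TopologicalSpace.SeparableSpace K] [PreconnectedSpace K] {F : K → LongRay → LongRay}
    (h₁ : ∀ y, Continuous (F y)) (h₂ : ∀ x, Continuous fun y => F y x) :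
    (∃ k, ∀ y x, F y x ≤ k) ∨ ∀ᶠ x in club, ∀ y, F y (ofOrd x) = ofOrd x := by
  obtain ⟨Q, hQc, hQd⟩ := TopologicalSpace.exists_countable_dense K
  have hk : ∀ q, ∃ k, BddAbove (range (F q)) → ∀ x, F q x ≤ k := fun q => by
    by_cases h : BddAbove (range (F q))
    · obtain ⟨k, hk⟩ := h
      exact ⟨k, fun _ x => hk (mem_range_self x)⟩
    · exact ⟨⊥, fun h' => absurd h' h⟩
  choose k hk using hk
  obtain ⟨a, ha⟩ := bddAbove_of_countable (hQc.image k)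
  -- Either all members indexed by the countable dense set are bounded, with the common bound `a`
  -- inherited by density, or some member is unbounded and fixes club many heights.
  by_cases hQ : ∀ q ∈ Q, BddAbove (range (F q))
  · left
    refine ⟨ofOrd a, fun y x => ?_⟩
    have hcl : IsClosed {y | F y x ≤ ofOrd a} := isClosed_le (h₂ x) continuous_const
    have : Q ⊆ {y | F y x ≤ ofOrd a} := fun q hq =>
      (hk q (hQ q hq) x).trans (ha _ (mem_image_of_mem _ hq)).le
    exact closure_minimal this hcl (hQd y)
  · right
    push Not at hQ
    obtain ⟨q₀, hq₀, hq₀'⟩ := hQ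
    have hall : ∀ᶠ x in club, ∀ q ∈ Q, F q (ofOrd x) ≤ ofOrd a ∨ F q (ofOrd x) = ofOrd x := by
      refine eventually_club_forall hQc fun q hq => ?_
      by_cases hb : BddAbove (range (F q))
      · exact Filter.Eventually.of_forall fun x =>
          Or.inl ((hk q hb _).trans (ha _ (mem_image_of_mem _ hq)).le)
      · filter_upwards [eventually_fixed (h₁ q) hb] with x hx using Or.inr hx
    filter_upwards [hall, eventually_fixed (h₁ q₀) hq₀', eventually_club_gt a] with x hx hx₀ hax
    -- At a height `x > a` the parameter space is the disjoint union of the closed sets `F ≤ a` and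
    -- `F = x`. The second contains `q₀`, so by connectedness it is everything.
    have hA : IsClosed {y | F y (ofOrd x) ≤ ofOrd a} := isClosed_le (h₂ _) continuous_const
    have hB : IsClosed {y | F y (ofOrd x) = ofOrd x} := isClosed_eq (h₂ _) continuous_const
    have hU : ∀ y, F y (ofOrd x) ≤ ofOrd a ∨ F y (ofOrd x) = ofOrd x := fun y =>
      closure_minimal (fun q hq => hx q hq) (hA.union hB) (hQd y)
    have hBo : IsOpen {y | F y (ofOrd x) = ofOrd x} := by
      convert hA.isOpen_compl using 1
      ext y
      refine ⟨fun h h' => ?_, fun h => (hU y).resolve_left h⟩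
      exact absurd (h.symm.trans_le h') (not_le.2 (ofOrd_lt_ofOrd.2 hax))
    have := IsClopen.eq_univ ⟨hB, hBo⟩ ⟨q₀, hx₀⟩
    exact fun y => this.symm.subset (mem_univ y)

end LongRay

/-! ### Spaces with a proper height function -/

section Height

variable {X : Type} [TopologicalSpace X] {H : X → LongRay}

/-- The Type I sequence given by a height function. -/
def typeISequenceOfHeight (hH : Continuous H) (hL : ∀ a, IsLindelof {x | H x ≤ LongRay.ofOrd a}) :
    TypeISequence X where
  piece a := {x | H x < LongRay.ofOrd a}
  isOpen_piece _ := isOpen_lt hH continuous_const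
  isLindelof_closure a := (hL a).of_isClosed_subset isClosed_closure
    (closure_minimal (fun x (hx : H x < _) => hx.le) (isClosed_le hH continuous_const))
  closure_subset a b hab := by
    have h₁ : closure {x | H x < LongRay.ofOrd a} ⊆ {x | H x ≤ LongRay.ofOrd a} :=
      closure_minimal (fun x (hx : H x < _) => hx.le) (isClosed_le hH continuous_const)
    exact h₁.trans fun _ hx => lt_of_le_of_lt hx (LongRay.ofOrd_lt_ofOrd.2 hab)
  iUnion_piece := eq_univ_of_forall fun x => mem_iUnion.2 (LongRay.exists_lt_ofOrd (H x))

theorem isTypeI_of_height (hH : Continuous H) (hL : ∀ a, IsLindelof {x | H x ≤ LongRay.ofOrd a})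
    (hu : ¬ BddAbove (range H)) : IsTypeI X := by
  refine ⟨fun hX => hu ?_, ⟨typeISequenceOfHeight hH hL⟩⟩
  exact LongRay.bddAbove_of_isLindelof (isLindelof_range hH)

/-- A continuous image of a Lindelöf set in the long ray is bounded, so the height is bounded on
each member of any Type I sequence. Boundedness can thus be measured by the height alone. -/
theorem isBoundedTypeI_iff (hH : Continuous H)
    (hL : ∀ a, IsLindelof {x | H x ≤ LongRay.ofOrd a}) {A : Set X} :
    IsBoundedTypeI A ↔ BddAbove (H '' A) := by
  constructor
  · rintro ⟨s, i, hA⟩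
    exact (LongRay.bddAbove_of_isLindelof ((s.isLindelof_closure i).image hH)).mono
      (image_mono (hA.trans subset_closure))
  · rintro ⟨m, hm⟩
    obtain ⟨a, ha⟩ := LongRay.exists_lt_ofOrd m
    refine ⟨typeISequenceOfHeight hH hL, a, fun x hx => ?_⟩
    change H x < LongRay.ofOrd a
    exact (hm (mem_image_of_mem H hx)).trans_lt ha

theorem bddAbove_image_of_height (hL : ∀ a, IsLindelof {x | H x ≤ LongRay.ofOrd a}) {A : Set X}
    (hA : BddAbove (H '' A)) {f : X → LongRay} (hf : Continuous f) : BddAbove (f '' A) := by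
  obtain ⟨m, hm⟩ := hA
  obtain ⟨a, ha⟩ := LongRay.exists_lt_ofOrd m
  exact (LongRay.bddAbove_of_isLindelof ((hL a).image hf)).mono
    (image_mono fun x hx => (hm (mem_image_of_mem _ hx)).trans ha.le)

end Height

/-! ### Coordinates on the pile -/

namespace OctantPile

variable {β : Ordinal.{0}} (h : β.ToType → OmegaOne)

/-- The height of a point. -/
def ht (p : OctantPile h) : LongRay := p.1.1

/-- The coordinate of a point in the octant `O_b`. -/
def crd (b : β.ToType) (p : OctantPile h) : LongRay := p.1.2 b

theorem continuous_ht : Continuous (ht h) := continuous_fst.comp continuous_subtype_val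

theorem continuous_crd (b : β.ToType) : Continuous (crd h b) :=
  (continuous_apply b).comp (continuous_snd.comp continuous_subtype_val)

variable {h}

theorem ext {p q : OctantPile h} (h₁ : ht h p = ht h q) (h₂ : ∀ b, crd h b p = crd h b q) :
    p = q :=
  Subtype.ext (Prod.ext h₁ (funext h₂))

theorem le_crd (b : β.ToType) (p : OctantPile h) : LongRay.ofOrd (h b) ≤ crd h b p := (p.2.1 b).1

theorem crd_le (b : β.ToType) (p : OctantPile h) :
    crd h b p ≤ max (LongRay.ofOrd (h b)) (ht h p) := (p.2.1 b).2

theorem crd_eq_of_lt {b c : β.ToType} (hbc : b < c) {p : OctantPile h}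
    (hc : LongRay.ofOrd (h c) < crd h c p) :
    crd h b p = max (LongRay.ofOrd (h b)) (ht h p) := p.2.2 b c hbc hc

theorem crd_eq_ofOrd_of_lt {b c : β.ToType} (hbc : b < c) {p : OctantPile h}
    (hb : crd h b p < max (LongRay.ofOrd (h b)) (ht h p)) :
    crd h c p = LongRay.ofOrd (h c) :=
  le_antisymm (not_lt.1 fun hc => hb.ne (crd_eq_of_lt hbc hc)) (le_crd c p)

theorem continuous_iff {Y : Type*} [TopologicalSpace Y] {f : Y → OctantPile h} :
    Continuous f ↔ Continuous (fun y => ht h (f y)) ∧ ∀ b, Continuous fun y => crd h b (f y) := by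
  refine ⟨fun hf => ⟨(continuous_ht h).comp hf, fun b => (continuous_crd h b).comp hf⟩,
    fun hf => ?_⟩
  exact continuous_induced_rng.2 (hf.1.prodMk (continuous_pi hf.2))

@[simp] theorem ht_side (γ : Ordinal.{0}) (x : LongRay) : ht h (side h γ x) = x := rfl

theorem crd_side_of_lt {γ : Ordinal.{0}} {b : β.ToType} (hb : (b : Ordinal) < γ) (x : LongRay) :
    crd h b (side h γ x) = max (LongRay.ofOrd (h b)) x := by
  simp [crd, side, hb]

theorem crd_side_of_le {γ : Ordinal.{0}} {b : β.ToType} (hb : γ ≤ (b : Ordinal)) (x : LongRay) :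
    crd h b (side h γ x) = LongRay.ofOrd (h b) := by
  simp [crd, side, not_lt.2 hb]

theorem crd_side_top (b : β.ToType) (x : LongRay) :
    crd h b (side h β x) = max (LongRay.ofOrd (h b)) x :=
  crd_side_of_lt (ToType.mk.symm b).2 x

variable (h) in
theorem continuous_side (γ : Ordinal.{0}) : Continuous (side h γ) := by
  refine continuous_iff.2 ⟨continuous_id, fun b => ?_⟩
  rcases lt_or_ge (b : Ordinal) γ with hb | hb
  · simp_rw [crd_side_of_lt hb]
    fun_prop
  · simp_rw [crd_side_of_le hb]
    fun_prop

theorem notMem_top {p : OctantPile h} {b : β.ToType} (hb : crd h b p < ht h p) :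
    p ∉ range (side h β) := by
  rintro ⟨x, rfl⟩
  rw [crd_side_top, ht_side] at hb
  exact absurd hb (not_lt.2 (le_max_right _ _))

theorem mem_range_side_iff {γ : Ordinal.{0}} {p : OctantPile h} :
    p ∈ range (side h γ) ↔ p = side h γ (ht h p) := by
  constructor
  · rintro ⟨x, rfl⟩; rfl
  · intro hp; exact ⟨_, hp.symm⟩

variable (h) in
theorem isClosed_range_side (γ : Ordinal.{0}) : IsClosed (range (side h γ)) := by
  have : range (side h γ) = {p | p = side h γ (ht h p)} :=
    Set.ext fun p => mem_range_side_iff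
  rw [this]
  exact isClosed_eq continuous_id ((continuous_side h γ).comp (continuous_ht h))

variable (h) in
/-- The point at height `x` in `O_b` whose coordinate there is the truncation of `y`. -/
def point (b : β.ToType) (x y : LongRay) : OctantPile h :=
  ⟨(x, fun c => if c < b then max (LongRay.ofOrd (h c)) x else
      if c = b then max (LongRay.ofOrd (h b)) (min y x) else LongRay.ofOrd (h c)), by
    refine ⟨fun c => ?_, fun c d hcd hd => ?_⟩
    · by_cases hcb : c < b
      · simp [hcb]
      · by_cases hcb' : c = b
        · subst hcb'
          simpa only [lt_self_iff_false, if_false, if_true] using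
            ⟨le_max_left _ _, max_le_max le_rfl (min_le_right _ _)⟩
        · simp [hcb, hcb']
    · by_cases hdb : d < b
      · simp [hcd.trans hdb]
      · by_cases hdb' : d = b
        · subst hdb'
          simp [hcd]
        · simp [hdb, hdb'] at hd⟩

@[simp] theorem ht_point (b : β.ToType) (x y : LongRay) : ht h (point h b x y) = x := rfl

@[simp] theorem crd_point_self (b : β.ToType) (x y : LongRay) :
    crd h b (point h b x y) = max (LongRay.ofOrd (h b)) (min y x) := by
  simp [crd, point]

theorem crd_point_of_lt {b c : β.ToType} (hc : c < b) (x y : LongRay) :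
    crd h c (point h b x y) = max (LongRay.ofOrd (h c)) x := by
  simp [crd, point, hc]

theorem crd_point_of_gt {b c : β.ToType} (hc : b < c) (x y : LongRay) :
    crd h c (point h b x y) = LongRay.ofOrd (h c) := by
  simp [crd, point, hc.not_gt, hc.ne']

variable (h) in
theorem continuous_point (b : β.ToType) : Continuous fun q : LongRay × LongRay =>
    point h b q.1 q.2 := by
  refine continuous_iff.2 ⟨continuous_fst, fun c => ?_⟩
  rcases lt_trichotomy c b with hc | rfl | hc
  · simp_rw [crd_point_of_lt hc]
    fun_prop
  · simp_rw [crd_point_self]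
    fun_prop
  · simp_rw [crd_point_of_gt hc]
    fun_prop

theorem coe_lt_coe {b c : β.ToType} : (b : Ordinal) < (c : Ordinal) ↔ b < c := by simp

theorem coe_le_coe {b c : β.ToType} : (b : Ordinal) ≤ (c : Ordinal) ↔ b ≤ c := by simp

theorem point_ofOrd (b : β.ToType) (x : LongRay) :
    point h b x (LongRay.ofOrd (h b)) = side h (b : Ordinal) x := by
  refine ext rfl fun c => ?_
  rcases lt_trichotomy c b with hc | rfl | hc
  · rw [crd_point_of_lt hc, crd_side_of_lt (coe_lt_coe.2 hc)]
  · rw [crd_point_self, crd_side_of_le le_rfl, max_eq_left (min_le_left _ _)]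
  · rw [crd_point_of_gt hc, crd_side_of_le (coe_le_coe.2 hc.le)]

theorem point_diagonal (b : β.ToType) (x : LongRay) :
    point h b x x = side h (Order.succ (b : Ordinal)) x := by
  refine ext rfl fun c => ?_
  rcases lt_trichotomy c b with hc | rfl | hc
  · rw [crd_point_of_lt hc, crd_side_of_lt (Order.lt_succ_iff.2 (coe_le_coe.2 hc.le))]
  · rw [crd_point_self, crd_side_of_lt (Order.lt_succ _), min_self]
  · rw [crd_point_of_gt hc, crd_side_of_le (Order.succ_le_iff.2 (coe_lt_coe.2 hc))]

theorem eq_point {p : OctantPile h} {b : β.ToType}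
    (hb : ∀ c < b, crd h c p = max (LongRay.ofOrd (h c)) (ht h p))
    (hb' : ∀ c, b < c → crd h c p = LongRay.ofOrd (h c)) :
    p = point h b (ht h p) (crd h b p) := by
  refine ext rfl fun c => ?_
  rcases lt_trichotomy c b with hc | rfl | hc
  · rw [crd_point_of_lt hc, hb c hc]
  · rw [crd_point_self, max_min_distrib_left, max_eq_right (le_crd _ _), min_eq_left (crd_le _ _)]
  · rw [crd_point_of_gt hc, hb' c hc]

/-- Every point off the upper side lies in an octant, below its diagonal. -/
theorem exists_crd_lt_of_notMem_top {p : OctantPile h} (hp : p ∉ range (side h β)) :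
    ∃ b, LongRay.ofOrd (h b) < ht h p ∧ crd h b p < ht h p ∧
      p = point h b (ht h p) (crd h b p) := by
  have hne : {b | crd h b p < max (LongRay.ofOrd (h b)) (ht h p)}.Nonempty := by
    by_contra hcon
    refine hp (mem_range_side_iff.2 (ext rfl fun b => ?_))
    rw [crd_side_top]
    exact le_antisymm (crd_le b p) (not_lt.1 fun hb => hcon ⟨b, hb⟩)
  -- The first coordinate that is not maximal: those before it are maximal by minimality, those
  -- after it minimal by the defining condition of the pile.
  let b := (wellFounded_lt (α := β.ToType)).min _ hne
  have hb : crd h b p < max (LongRay.ofOrd (h b)) (ht h p) :=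
    (wellFounded_lt (α := β.ToType)).min_mem _ hne
  have hlt : LongRay.ofOrd (h b) < ht h p := by
    rcases lt_max_iff.1 ((le_crd b p).trans_lt hb) with h1 | h1
    · exact absurd h1 (lt_irrefl _)
    · exact h1
  refine ⟨b, hlt, by rwa [max_eq_right hlt.le] at hb, eq_point (fun c hc => ?_)
    fun c hc => crd_eq_ofOrd_of_lt hc hb⟩
  by_contra hcon
  exact (wellFounded_lt (α := β.ToType)).not_lt_min _
    (show c ∈ {b | crd h b p < max (LongRay.ofOrd (h b)) (ht h p)} from
      lt_of_le_of_ne (crd_le c p) hcon) hc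

/-! ### Compactness -/

variable (h) in
-- The implication defining the pile is a closed condition, being the disjunction of `u_c ≤ h c` and
-- an equation.
theorem isClosedEmbedding_val : IsClosedEmbedding
    (Subtype.val : OctantPile h → LongRay × (β.ToType → LongRay)) := by
  have hset : {p : LongRay × (β.ToType → LongRay) |
      (∀ b, LongRay.ofOrd (h b) ≤ p.2 b ∧ p.2 b ≤ max (LongRay.ofOrd (h b)) p.1) ∧
      ∀ b c, b < c → LongRay.ofOrd (h c) < p.2 c → p.2 b = max (LongRay.ofOrd (h b)) p.1} =
      (⋂ b, {p | LongRay.ofOrd (h b) ≤ p.2 b} ∩ {p | p.2 b ≤ max (LongRay.ofOrd (h b)) p.1}) ∩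
      ⋂ b, ⋂ c, ⋂ _ : b < c, {p | p.2 c ≤ LongRay.ofOrd (h c)} ∪
        {p | p.2 b = max (LongRay.ofOrd (h b)) p.1} := by
    ext p
    simp only [mem_ofPred_eq, mem_inter_iff, mem_iInter, mem_union, ← not_lt (b := p.2 _),
      ← imp_iff_not_or]
  refine IsClosed.isClosedEmbedding_subtypeVal (s := {p | _}) ?_
  rw [hset]
  refine IsClosed.inter ?_ ?_
  · refine isClosed_iInter fun b => IsClosed.inter ?_ ?_
    · exact isClosed_le continuous_const (by fun_prop)
    · exact isClosed_le (by fun_prop) (continuous_const.max (by fun_prop))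
  · refine isClosed_iInter fun b => isClosed_iInter fun c => isClosed_iInter fun _ => ?_
    refine IsClosed.union ?_ ?_
    · exact isClosed_le (by fun_prop) continuous_const
    · exact isClosed_eq (by fun_prop) (continuous_const.max (by fun_prop))

variable (h) in
theorem isCompact_ht_le (x : LongRay) : IsCompact {p | ht h p ≤ x} := by
  have hK : IsCompact (Iic x ×ˢ univ.pi fun b => Iic (max (LongRay.ofOrd (h b)) x)) :=
    (LongRay.isCompact_Iic x).prod (isCompact_univ_pi fun b => LongRay.isCompact_Iic _)
  refine ((isClosedEmbedding_val h).isCompact_preimage hK).of_isClosed_subset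
    (isClosed_le (continuous_ht h) continuous_const) fun p hp => ⟨hp, fun b _ => ?_⟩
  exact (crd_le b p).trans (max_le_max le_rfl hp)

variable (h) in
theorem isOmegaBounded : IsOmegaBounded (OctantPile h) := fun A hA => by
  obtain ⟨a, ha⟩ := LongRay.bddAbove_of_countable (hA.image (ht h))
  refine (isCompact_ht_le h (LongRay.ofOrd a)).of_isClosed_subset isClosed_closure
    (closure_minimal (fun p hp => (ha _ (mem_image_of_mem _ hp)).le) ?_)
  exact isClosed_le (continuous_ht h) continuous_const

/-! ### Limits of unbounded sets -/

/-- The hypothesis on `A` says that these coordinates escape along `D`. Cluster points of suitably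
chosen members of `D` then have maximal coordinates in `A`; this is how club subsets of a direction
on a side or in an octant are found. -/
theorem eventually_exists_mem_closure (hh : Function.Injective h) {D : Set (OctantPile h)}
    (hD : ∀ a, ∃ p ∈ D, LongRay.ofOrd a < ht h p) {A : Set β.ToType}
    (hA : ∀ b ∈ A, ∀ a, ∃ a', ∀ p ∈ D, crd h b p ≤ LongRay.ofOrd a → ht h p ≤ LongRay.ofOrd a') :
    ∀ᶠ x in club, ∃ p ∈ closure D, ht h p = LongRay.ofOrd x ∧
      ∀ b ∈ A, crd h b p = max (LongRay.ofOrd (h b)) (LongRay.ofOrd x) := by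
  have hA' : ∀ b a, ∃ a', b ∈ A → ∀ p ∈ D, crd h b p ≤ LongRay.ofOrd a →
      ht h p ≤ LongRay.ofOrd a' := fun b a => by
    by_cases hb : b ∈ A
    · obtain ⟨a', ha'⟩ := hA b hb a
      exact ⟨a', fun _ => ha'⟩
    · exact ⟨⊥, fun hb' => absurd hb' hb⟩
  choose k hk using hA'
  -- By injectivity only countably many `b` have `h b ≤ ζ`, so a single height beyond all their
  -- bounds makes all these coordinates exceed `ζ` at once.
  have hp : ∀ ζ, ∃ p ∈ D, LongRay.ofOrd ζ < ht h p ∧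
      ∀ b ∈ A, h b ≤ ζ → LongRay.ofOrd ζ < crd h b p := fun ζ => by
    obtain ⟨m, hm⟩ := OmegaOne.exists_gt_of_countable
      ((((OmegaOne.countable_Iic ζ).preimage hh).image fun b => k b ζ).insert ζ)
    obtain ⟨p, hpD, hpm⟩ := hD m
    refine ⟨p, hpD, (LongRay.ofOrd_lt_ofOrd.2 (hm ζ (mem_insert _ _))).trans hpm,
      fun b hb hbζ => not_le.1 fun hcon => ?_⟩
    refine absurd ((hk b ζ hb p hpD hcon).trans (LongRay.ofOrd_le_ofOrd.2 (hm (k b ζ) ?_).le))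
      (not_le.2 hpm)
    exact mem_insert_of_mem _ ⟨b, hbζ, rfl⟩
  choose p hpD hpht hpc using hp
  choose g hg using fun ζ => LongRay.exists_lt_ofOrd (ht h (p ζ))
  filter_upwards [eventually_club_closed g, eventually_club_limit, eventually_club_gt ⊥]
    with x hx hlim h0
  have : Nonempty (Iio x) := ⟨⟨⊥, h0⟩⟩
  let 𝓕 : Filter (OctantPile h) := Filter.map (fun ζ : Iio x => p ζ) Filter.atTop
  have hF : 𝓕.NeBot := Filter.map_neBot
  -- Closure of `x` under `g` keeps all `p ζ`, `ζ < x`, in the compact part of height at most `x`,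
  -- where they have a cluster point.
  obtain ⟨q, hq, hqF⟩ := (isCompact_ht_le h (LongRay.ofOrd x)) (f := 𝓕) (by
    rw [Filter.le_principal_iff, Filter.mem_map]
    exact Filter.univ_mem' fun ζ => ((hg ζ).trans (LongRay.ofOrd_lt_ofOrd.2 (hx _ ζ.2))).le)
  have hmem : ∀ S : Set (OctantPile h), IsClosed S → ∀ a < x, (∀ ζ, a ≤ ζ → ζ < x → p ζ ∈ S) →
      q ∈ S := fun S hS a ha hSp => by
    rw [← hS.closure_eq, mem_closure_iff_clusterPt]
    refine hqF.mono ?_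
    rw [Filter.le_principal_iff, Filter.mem_map]
    filter_upwards [Filter.eventually_ge_atTop (⟨a, ha⟩ : Iio x)] with ζ hζ
      using hSp ζ hζ ζ.2
  have hsup : ∀ y : LongRay, (∀ a < x, LongRay.ofOrd a ≤ y) → LongRay.ofOrd x ≤ y := fun y hy => by
    by_contra hcon
    obtain ⟨ζ, hζ, hyζ⟩ := hlim y (not_le.1 hcon)
    exact absurd (hy ζ hζ) (not_le.2 hyζ)
  have hqx : ht h q = LongRay.ofOrd x := by
    refine le_antisymm hq (hsup _ fun a ha => ?_)
    exact hmem {p | LongRay.ofOrd a ≤ ht h p} (isClosed_le continuous_const (continuous_ht h)) a ha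
      fun ζ haζ _ => (LongRay.ofOrd_le_ofOrd.2 haζ).trans (hpht ζ).le
  refine ⟨q, hmem _ isClosed_closure ⊥ h0 fun ζ _ _ => subset_closure (hpD ζ), hqx,
    fun b hb => ?_⟩
  refine le_antisymm ((crd_le b q).trans_eq (by rw [hqx])) (max_le (le_crd b q) ?_)
  rcases le_or_gt x (h b) with hxb | hxb
  · exact (LongRay.ofOrd_le_ofOrd.2 hxb).trans (le_crd b q)
  · refine hsup _ fun a ha => hmem {p | LongRay.ofOrd a ≤ crd h b p}
      (isClosed_le continuous_const (continuous_crd h b)) (max a (h b)) (max_lt ha hxb)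
      fun ζ haζ _ => ?_
    exact (LongRay.ofOrd_le_ofOrd.2 ((le_max_left _ _).trans haζ)).trans
      (hpc ζ b hb ((le_max_right _ _).trans haζ)).le

end OctantPile

/-! ### Functions on the pile -/

namespace OctantPile

variable {β : Ordinal.{0}} {h : β.ToType → OmegaOne} {R : Set (OctantPile h)}
  {F : OctantPile h → LongRay}

/-- Continuity of `F` is only available on `R`, so the rays are frozen below height `a` to obtain
functions continuous on the whole long ray. -/
theorem bounded_or_eventually_fixed {K : Type*} [TopologicalSpace K]
    [TopologicalSpace.SeparableSpace K] [PreconnectedSpace K] 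
    (hF : ContinuousOn F R) {σ : K → LongRay → OctantPile h} {a : OmegaOne}
    (h₁ : ∀ y, Continuous (σ y)) (h₂ : ∀ x, Continuous fun y => σ y x)
    (ha : ∀ y, ∀ x ≥ LongRay.ofOrd a, σ y x ∈ R) :
    (∃ k, ∀ y, ∀ x ≥ LongRay.ofOrd a, F (σ y x) ≤ k) ∨
      ∀ᶠ x in club, ∀ y, F (σ y (LongRay.ofOrd x)) = LongRay.ofOrd x := by
  have hmem : ∀ y x, σ y (max x (LongRay.ofOrd a)) ∈ R := fun y x => ha y _ (le_max_right _ _)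
  rcases LongRay.bounded_or_eventually_fixed (F := fun y x => F (σ y (max x (LongRay.ofOrd a))))
    (fun y => hF.comp_continuous ((h₁ y).comp (continuous_id.max continuous_const)) (hmem y))
    (fun x => hF.comp_continuous (h₂ _) fun y => hmem y x) with ⟨k, hk⟩ | hev
  · left
    refine ⟨k, fun y x hx => ?_⟩
    have := hk y x
    rwa [max_eq_left hx] at this
  · right
    filter_upwards [hev, eventually_club_gt a] with x hx hax y
    have := hx y
    rwa [max_eq_left (LongRay.ofOrd_le_ofOrd.2 hax.le)] at this

theorem crd_point_of_mem {b : β.ToType} {x y : LongRay} (hy : LongRay.ofOrd (h b) ≤ y)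
    (hyx : y ≤ x) : crd h b (point h b x y) = y := by
  rw [crd_point_self, min_eq_left hyx, max_eq_right hy]

theorem point_notMem_top {b : β.ToType} {x y : LongRay} (hy : LongRay.ofOrd (h b) ≤ y)
    (hyx : y < x) : point h b x y ∉ range (side h β) :=
  notMem_top (b := b) (by rwa [crd_point_of_mem hy hyx.le])

theorem side_notMem_top {b : β.ToType} {x : LongRay} (hx : LongRay.ofOrd (h b) < x) :
    side h (b : Ordinal) x ∉ range (side h β) := by
  rw [← point_ofOrd]
  exact point_notMem_top le_rfl hx

/-- On a horizontal strip in an octant, a continuous function is bounded, or it agrees with the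
height at club many heights. -/
theorem strip_bounded_or_eventually_fixed (hR' : ∀ p ∉ range (side h β), p ∈ R)
    (hF : ContinuousOn F R) (b : β.ToType) {η : LongRay} (hη : LongRay.ofOrd (h b) ≤ η) :
    (∃ k a, ∀ x ≥ LongRay.ofOrd a, ∀ y ∈ Icc (LongRay.ofOrd (h b)) η, F (point h b x y) ≤ k) ∨
      ∀ᶠ x in club, ∀ y ∈ Icc (LongRay.ofOrd (h b)) η,
        F (point h b (LongRay.ofOrd x) y) = LongRay.ofOrd x := by
  obtain ⟨a, ha⟩ := LongRay.exists_lt_ofOrd η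
  have := LongRay.preconnectedSpace_Icc hη
  have := LongRay.separableSpace_Icc hη
  rcases bounded_or_eventually_fixed hF (a := a)
    (σ := fun (y : Icc (LongRay.ofOrd (h b)) η) x => point h b x y)
    (fun y => (continuous_point h b).comp (by fun_prop : Continuous fun x => (x, (y : LongRay))))
    (fun x => (continuous_point h b).comp
      (by fun_prop : Continuous fun y : Icc (LongRay.ofOrd (h b)) η => (x, (y : LongRay))))
    (fun y x hx => hR' _ (point_notMem_top y.2.1 ((y.2.2.trans_lt ha).trans_le hx)))
    with ⟨k, hk⟩ | hev
  · exact Or.inl ⟨k, a, fun x hx y hy => hk ⟨y, hy⟩ x hx⟩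
  · right
    filter_upwards [hev] with x hx y hy using hx ⟨y, hy⟩

/-- The bounded alternative fails already on the lower edge `y = h b` of the strip, which is `Δ_b`.
-/
theorem strip_eventually_fixed (hR' : ∀ p ∉ range (side h β), p ∈ R)
    (hF : ContinuousOn F R) {b : β.ToType}
    (hb : ∀ᶠ x in club, F (side h (b : Ordinal) (LongRay.ofOrd x)) = LongRay.ofOrd x)
    {η : LongRay} (hη : LongRay.ofOrd (h b) ≤ η) :
    ∀ᶠ x in club, ∀ y ∈ Icc (LongRay.ofOrd (h b)) η,
      F (point h b (LongRay.ofOrd x) y) = LongRay.ofOrd x := by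
  refine (strip_bounded_or_eventually_fixed hR' hF b hη).resolve_left ?_
  rintro ⟨k, a, hk⟩
  obtain ⟨c, hc⟩ := LongRay.exists_lt_ofOrd k
  obtain ⟨x, hx, hx'⟩ := hb.exists_gt_of_club (max a c)
  have := hk (LongRay.ofOrd x) (LongRay.ofOrd_le_ofOrd.2 ((le_max_left _ _).trans hx.le)) _
    ⟨le_rfl, hη⟩
  rw [point_ofOrd, hx'] at this
  exact absurd (this.trans_lt hc) (not_lt.2 (LongRay.ofOrd_le_ofOrd.2
    ((le_max_right _ _).trans hx.le)))

/-- A diagonal intersection over the lines at ordinal levels `η`. At a limit height these levels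
accumulate at the diagonal, which no single strip reaches. -/
theorem octant_eventually_fixed (hR' : ∀ p ∉ range (side h β), p ∈ R)
    (hF : ContinuousOn F R) {b : β.ToType}
    (hb : ∀ᶠ x in club, F (side h (b : Ordinal) (LongRay.ofOrd x)) = LongRay.ofOrd x) :
    ∀ᶠ x in club, ∀ η < x, h b ≤ η →
      F (point h b (LongRay.ofOrd x) (LongRay.ofOrd η)) = LongRay.ofOrd x := by
  refine eventually_club_diagonal (r := id) (fun a => by simp) fun η => ?_
  by_cases hη : h b ≤ η
  · filter_upwards [strip_eventually_fixed hR' hF hb (LongRay.ofOrd_le_ofOrd.2 hη)]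
      with x hx _ using hx _ ⟨LongRay.ofOrd_le_ofOrd.2 hη, le_rfl⟩
  · exact Filter.Eventually.of_forall fun x hcon => absurd hcon hη

/-- At a fixed height each coordinate of `Δ_d` is eventually constant as `d` tends to `c`, so the
points of `Δ_d` converge to that of `Δ_c`. -/
theorem exists_side_mem_of_isSuccLimit {c γ : Ordinal.{0}} (hc : Order.IsSuccLimit c) (hγ : γ < c)
    {x : LongRay} {U : Set (OctantPile h)} (hU : U ∈ 𝓝 (side h c x)) :
    ∃ d, γ ≤ d ∧ d < c ∧ side h d x ∈ U := by
  have : Nonempty (Iio c) := ⟨⟨γ, hγ⟩⟩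
  have ht : Filter.Tendsto (fun d : Iio c => side h d x) Filter.atTop (𝓝 (side h c x)) := by
    refine tendsto_subtype_rng.2 (Filter.Tendsto.prodMk_nhds tendsto_const_nhds ?_)
    refine tendsto_pi_nhds.2 fun b => ?_
    refine tendsto_const_nhds.congr' ?_
    change ∀ᶠ d : Iio c in Filter.atTop, crd h b (side h c x) = crd h b (side h d x)
    rcases lt_or_ge (b : Ordinal) c with hb | hb
    · filter_upwards [Filter.eventually_ge_atTop (⟨_, hc.succ_lt hb⟩ : Iio c)] with d hd
      rw [crd_side_of_lt hb, crd_side_of_lt (Order.succ_le_iff.1 hd)]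
    · filter_upwards with d
      rw [crd_side_of_le hb, crd_side_of_le (d.2.le.trans hb)]
  obtain ⟨d, hdU, hd⟩ := ((ht.eventually hU).and
    (Filter.eventually_ge_atTop (⟨γ, hγ⟩ : Iio c))).exists
  exact ⟨d, hd, d.2, hdU⟩

/-- If `f` is unbounded on `Δ_γ`, then it is unbounded on `Δ_δ` for all larger `δ`. -/
theorem side_eventually_fixed_mono (hh : Function.Injective h) (hR : IsOpen R)
    (hR' : ∀ p ∉ range (side h β), p ∈ R) (hF : ContinuousOn F R) {γ : Ordinal.{0}}
    (hγ : ∀ᶠ x in club, F (side h γ (LongRay.ofOrd x)) = LongRay.ofOrd x) (δ : Ordinal.{0})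
    (hγδ : γ ≤ δ) (hδβ : δ ≤ β) (hδ : ∃ a, ∀ x ≥ LongRay.ofOrd a, side h δ x ∈ R) :
    ∀ᶠ x in club, F (side h δ (LongRay.ofOrd x)) = LongRay.ofOrd x := by
  induction δ using WellFoundedLT.induction with
  | ind δ ih =>
  obtain ⟨a, ha⟩ := hδ
  -- There may be uncountably many `d`, but at height `x` only those with `h d < x` matter: this is
  -- a diagonal intersection with rank `h`, whose fibres are countable by injectivity.
  have hoct : ∀ᶠ x in club, ∀ d : β.ToType, h d < x → γ ≤ (d : Ordinal) → (d : Ordinal) < δ →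
      ∀ η < x, h d ≤ η →
        F (point h d (LongRay.ofOrd x) (LongRay.ofOrd η)) = LongRay.ofOrd x := by
    refine eventually_club_diagonal
      (fun c => ((countable_singleton c).preimage hh)) fun d => ?_
    by_cases hd : γ ≤ (d : Ordinal) ∧ (d : Ordinal) < δ
    · obtain ⟨a', ha'⟩ := exists_gt (h d)
      filter_upwards [octant_eventually_fixed hR' hF (ih d hd.2 hd.1 (hd.2.le.trans hδβ)
        ⟨a', fun x hx => hR' _ (side_notMem_top
          ((LongRay.ofOrd_lt_ofOrd.2 ha').trans_le hx))⟩)] with x hx _ _ using hx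
    · exact Filter.Eventually.of_forall fun x h1 h2 => absurd ⟨h1, h2⟩ hd
  filter_upwards [hoct, hγ, eventually_club_limit, eventually_club_gt a, eventually_club_gt ⊥]
    with x hx hγx hlim hax h0
  by_contra hcon
  -- At this one height, consider the least side in `[γ, δ]` where `F` differs from the height; a
  -- second induction inside the slice rules it out.
  have hne : {c | γ ≤ c ∧ c ≤ δ ∧ F (side h c (LongRay.ofOrd x)) ≠ LongRay.ofOrd x}.Nonempty :=
    ⟨δ, hγδ, le_rfl, hcon⟩
  obtain ⟨c, ⟨hγc, hcδ, hFc⟩, hmin⟩ := wellFounded_lt.has_min _ hne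
  have hlt : γ < c := lt_of_le_of_ne hγc fun e => hFc (e ▸ hγx)
  -- If this point is already on the upper side, all later sides, among them `Δ_δ`, pass through it
  -- too, and `Δ_δ` lies in `R` at this height.
  have hcR : side h c (LongRay.ofOrd x) ∈ R := by
    by_cases htop : side h c (LongRay.ofOrd x) ∈ range (side h β)
    · have e := mem_range_side_iff.1 htop
      have : side h c (LongRay.ofOrd x) = side h δ (LongRay.ofOrd x) := by
        refine ext rfl fun b => ?_
        rcases lt_or_ge (b : Ordinal) c with hb | hb
        · rw [crd_side_of_lt hb, crd_side_of_lt (hb.trans_le hcδ)]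
        · rcases lt_or_ge (b : Ordinal) δ with hb' | hb'
          · rw [e, ht_side, crd_side_top, crd_side_of_lt hb']
          · rw [crd_side_of_le hb, crd_side_of_le hb']
      rw [this]
      exact ha _ (LongRay.ofOrd_le_ofOrd.2 hax.le)
    · exact hR' _ htop
  have hU : {p | F p ≠ LongRay.ofOrd x} ∈ 𝓝 (side h c (LongRay.ofOrd x)) :=
    (hF.continuousAt (hR.mem_nhds hcR)).eventually_ne hFc
  rcases Ordinal.zero_or_succ_or_isSuccLimit c with rfl | ⟨d, rfl⟩ | hc
  · exact absurd hlt (not_lt.2 zero_le)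
  · have hγd : γ ≤ d := Order.lt_succ_iff.1 hlt
    have hdδ : d < δ := Order.succ_le_iff.1 hcδ
    obtain ⟨b, rfl⟩ : ∃ b : β.ToType, (b : Ordinal) = d :=
      ⟨ToType.mk ⟨d, hdδ.trans_le hδβ⟩, by simp⟩
    rcases lt_or_ge (h b) x with hbx | hbx
    · rw [← point_diagonal] at hU
      have hcont : Continuous fun y => point h b (LongRay.ofOrd x) y :=
        (continuous_point h b).comp (by fun_prop : Continuous fun y => (LongRay.ofOrd x, y))
      obtain ⟨l, hl, hlU⟩ := exists_Ioc_subset_of_mem_nhds (hcont.continuousAt hU)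
        ⟨LongRay.ofOrd ⊥, LongRay.ofOrd_lt_ofOrd.2 h0⟩
      obtain ⟨ζ, hζ, hlζ⟩ := hlim l hl
      have hm : max ζ (h b) < x := max_lt hζ hbx
      exact hlU ⟨hlζ.trans_le (LongRay.ofOrd_le_ofOrd.2 (le_max_left _ _)),
        (LongRay.ofOrd_lt_ofOrd.2 hm).le⟩ (hx b hbx hγd hdδ _ hm (le_max_right _ _))
    · refine hmin _ ⟨hγd, hdδ.le, fun hFd => hFc ?_⟩ (Order.lt_succ _)
      refine Eq.trans (congrArg F ?_) hFd
      rw [← point_diagonal, ← point_ofOrd]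
      refine ext rfl fun e => ?_
      rcases lt_trichotomy e b with he | rfl | he
      · rw [crd_point_of_lt he, crd_point_of_lt he]
      · rw [crd_point_self, crd_point_self, min_self, max_eq_left (LongRay.ofOrd_le_ofOrd.2 hbx),
          max_eq_left (min_le_left _ _)]
      · rw [crd_point_of_gt he, crd_point_of_gt he]
  · obtain ⟨d, hγd, hdc, hdU⟩ := exists_side_mem_of_isSuccLimit hc hlt hU
    exact hmin d ⟨hγd, hdc.le.trans hcδ, hdU⟩ hdc

end OctantPile

/-! ### Discrete families of open sets -/

section DiscreteFamily

variable {X : Type} [TopologicalSpace X] {ι : Type*} {U : ι → Set X} {q : ι → X}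

/-- Prescribed values at the points of a discrete family are taken by a continuous function. -/
theorem exists_continuous_longRay_of_discrete [CompletelyRegularSpace X] (hU : ∀ i, IsOpen (U i))
    (hq : ∀ i, q i ∈ U i) (hd : ∀ x, ∃ V ∈ 𝓝 x, {i | (U i ∩ V).Nonempty}.Subsingleton)
    (y : ι → LongRay) : ∃ f : X → LongRay, Continuous f ∧ ∀ i, f (q i) = y i := by
  classical
  have hg : ∀ i, ∃ g : X → LongRay, Continuous g ∧ g (q i) = y i ∧ ∀ x ∉ U i, g x = ⊥ := fun i => by
    obtain ⟨r, hr, hr0, hr1⟩ := CompletelyRegularSpace.completely_regular (q i) (U i)ᶜ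
      (hU i).isClosed_compl (fun hcon => hcon (hq i))
    obtain ⟨γ, hγ, hγ0, hγ1⟩ := LongRay.exists_path (y i)
    -- The separating function is `0` at `q i` and `1` off `U i`, while the path starts at `⊥`;
    -- hence the reversal.
    refine ⟨fun x => γ (unitInterval.symm (r x)), hγ.comp (unitInterval.continuous_symm.comp hr),
      by simp [hr0, hγ1], fun x hx => ?_⟩
    have : r x = 1 := hr1 hx
    simp [this, hγ0]
  choose g hg hgq hgU using hg
  have huniq : ∀ x i j, x ∈ U i → x ∈ U j → i = j := fun x i j hi hj => by
    obtain ⟨V, hV, hs⟩ := hd x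
    exact hs ⟨x, hi, mem_of_mem_nhds hV⟩ ⟨x, hj, mem_of_mem_nhds hV⟩
  let f : X → LongRay := fun x => if hx : ∃ i, x ∈ U i then g hx.choose x else ⊥
  have hfU : ∀ i, ∀ x ∈ U i, f x = g i x := fun i x hx => by
    have hex : ∃ i, x ∈ U i := ⟨i, hx⟩
    simp only [f, dif_pos hex]
    rw [huniq x _ i hex.choose_spec hx]
  have hfn : ∀ x, (∀ i, x ∉ U i) → f x = ⊥ := fun x hx => by
    simp only [f]
    rw [dif_neg (by simpa using hx)]
  refine ⟨f, continuous_iff_continuousAt.2 fun x => ?_, fun i => by rw [hfU i _ (hq i), hgq]⟩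
  obtain ⟨V, hV, hs⟩ := hd x
  by_cases hex : ∃ i, (U i ∩ V).Nonempty
  · obtain ⟨i, hi⟩ := hex
    refine (hg i).continuousAt.congr ?_
    filter_upwards [hV] with z hz
    by_cases hzi : ∃ j, z ∈ U j
    · obtain ⟨j, hj⟩ := hzi
      obtain rfl : j = i := hs ⟨z, hj, hz⟩ hi
      exact (hfU _ _ hj).symm
    · push Not at hzi
      rw [hfn z hzi, hgU i z (hzi i)]
  · refine (continuousAt_const (y := (⊥ : LongRay))).congr ?_
    filter_upwards [hV] with z hz
    exact (hfn z fun i hi => hex ⟨i, z, hi, hz⟩).symm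

theorem isClosed_image_of_discrete [T1Space X] (hq : ∀ i, q i ∈ U i)
    (hd : ∀ x, ∃ V ∈ 𝓝 x, {i | (U i ∩ V).Nonempty}.Subsingleton) (S : Set ι) :
    IsClosed (q '' S) := by
  rw [image_eq_iUnion, biUnion_eq_iUnion]
  refine LocallyFinite.isClosed_iUnion (fun x => ?_) fun _ => isClosed_singleton
  obtain ⟨V, hV, hs⟩ := hd x
  refine ⟨V, hV, Subsingleton.finite ?_⟩
  rintro i ⟨_, rfl, hi⟩ j ⟨_, rfl, hj⟩
  exact Subtype.ext (hs ⟨_, hq _, hi⟩ ⟨_, hq _, hj⟩)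

end DiscreteFamily

/-! ### Directions in open parts of a pile -/

namespace OctantPile

variable {β : Ordinal.{0}} {h : β.ToType → OmegaOne} {X : Type} {e : X → OctantPile h}

variable (e) in
/-- A final segment of `Δ_γ` lies in the part. -/
def Reaches (γ : Ordinal.{0}) : Prop :=
  γ ≤ β ∧ ∃ a, ∀ x ≥ LongRay.ofOrd a, side h γ x ∈ range e

variable (e) in
/-- The part of `Δ_γ` in the space. -/
def ray (γ : Ordinal.{0}) : Set X := e ⁻¹' range (side h γ)

variable (e) in
/-- The extension by `0` of a function to the whole pile. -/
def extend (f : X → LongRay) : OctantPile h → LongRay := Function.extend e f fun _ => ⊥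

theorem not_bddAbove_of_eventually {f : X → LongRay} {C : Set X}
    (hf : ∀ᶠ x in club, ∃ q ∈ C, f q = LongRay.ofOrd x) : ¬ BddAbove (f '' C) := by
  rw [LongRay.not_bddAbove_iff]
  intro a
  obtain ⟨x, hx, q, hq, hfq⟩ := hf.exists_gt_of_club a
  exact ⟨_, mem_image_of_mem _ hq, hfq ▸ LongRay.ofOrd_lt_ofOrd.2 hx⟩

theorem eventually_exists_mem_ray {γ : Ordinal.{0}} (hγ : Reaches e γ) :
    ∀ᶠ x in club, ∃ q ∈ ray e γ, e q = side h γ (LongRay.ofOrd x) := by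
  obtain ⟨-, a, ha⟩ := hγ
  filter_upwards [eventually_club_gt a] with x hx
  obtain ⟨q, hq⟩ := ha _ (LongRay.ofOrd_le_ofOrd.2 hx.le)
  exact ⟨q, ⟨_, hq.symm⟩, hq⟩

variable [TopologicalSpace X]

variable (h e) in
/-- An open embedding onto a set that contains everything but the upper side of the pile, the
parts of bounded height being Lindelöf. -/
structure IsPart : Prop where
  injective : Function.Injective h
  isOpenEmbedding : IsOpenEmbedding e
  mem_range : ∀ p ∉ range (side h β), p ∈ range e
  isLindelof : ∀ a, IsLindelof {q | ht h (e q) ≤ LongRay.ofOrd a}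

namespace IsPart

theorem continuous_height (he : IsPart h e) : Continuous fun q => ht h (e q) :=
  (continuous_ht h).comp he.isOpenEmbedding.continuous

theorem extend_apply (he : IsPart h e) (f : X → LongRay) (q : X) : extend e f (e q) = f q :=
  he.isOpenEmbedding.injective.extend_apply _ _ _

theorem continuousOn_extend (he : IsPart h e) {f : X → LongRay} (hf : Continuous f) :
    ContinuousOn (extend e f) (range e) := by
  rintro _ ⟨q, rfl⟩
  refine ContinuousAt.continuousWithinAt (he.isOpenEmbedding.continuousAt_iff.1 ?_)
  rw [show extend e f ∘ e = f from funext (he.extend_apply f)]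
  exact hf.continuousAt

theorem isClubSet_iff (he : IsPart h e) {C : Set X} :
    IsClubSet C ↔ IsClosed C ∧ ∀ a, ∃ q ∈ C, LongRay.ofOrd a < ht h (e q) := by
  rw [IsClubSet, isBoundedTypeI_iff he.continuous_height he.isLindelof, LongRay.not_bddAbove_iff]
  simp

theorem mem_of_mem_closure_image (he : IsPart h e) {C : Set X} (hC : IsClosed C) {q : X}
    (hq : e q ∈ closure (e '' C)) : q ∈ C := by
  rw [← hC.closure_eq, he.isOpenEmbedding.isInducing.closure_eq_preimage_closure_image]
  exact hq

theorem isClubSet_of_eventually (he : IsPart h e) {C : Set X} (hC : IsClosed C)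
    (hf : ∀ᶠ x in club, ∃ q ∈ C, ht h (e q) = LongRay.ofOrd x) : IsClubSet C := by
  refine he.isClubSet_iff.2 ⟨hC, fun a => ?_⟩
  obtain ⟨x, hx, q, hq, hfq⟩ := hf.exists_gt_of_club a
  exact ⟨q, hq, hfq ▸ LongRay.ofOrd_lt_ofOrd.2 hx⟩

/-- A continuous function is bounded on a set if it is bounded on its part beyond some height. -/
theorem bddAbove_image (he : IsPart h e) {f : X → LongRay} (hf : Continuous f) {C : Set X}
    {k : LongRay} {a : OmegaOne}
    (hk : ∀ q ∈ C, LongRay.ofOrd a ≤ ht h (e q) → f q ≤ k) : BddAbove (f '' C) := by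
  have h1 : BddAbove (f '' {q | ht h (e q) ≤ LongRay.ofOrd a}) :=
    bddAbove_image_of_height he.isLindelof ⟨LongRay.ofOrd a, by rintro _ ⟨q, hq, rfl⟩; exact hq⟩ hf
  obtain ⟨m, hm⟩ := h1
  refine ⟨max m k, ?_⟩
  rintro _ ⟨q, hq, rfl⟩
  rcases le_total (ht h (e q)) (LongRay.ofOrd a) with hqa | hqa
  · exact (hm (mem_image_of_mem f hqa)).trans (le_max_left _ _)
  · exact (hk q hq hqa).trans (le_max_right _ _)

theorem isClosed_ray (he : IsPart h e) (γ : Ordinal.{0}) : IsClosed (ray e γ) :=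
  (isClosed_range_side h γ).preimage he.isOpenEmbedding.continuous

theorem isClubSet_ray (he : IsPart h e) {γ : Ordinal.{0}} (hγ : Reaches e γ) :
    IsClubSet (ray e γ) := by
  refine he.isClubSet_of_eventually (he.isClosed_ray γ) ?_
  filter_upwards [eventually_exists_mem_ray hγ] with x ⟨q, hq, hqx⟩
  exact ⟨q, hq, by rw [hqx, ht_side]⟩

theorem eventually_fixed_of_unbounded (he : IsPart h e) {γ : Ordinal.{0}} (hγ : Reaches e γ)
    {f : X → LongRay} (hf : Continuous f) (hu : ¬ BddAbove (f '' ray e γ)) :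
    ∀ᶠ x in club, extend e f (side h γ (LongRay.ofOrd x)) = LongRay.ofOrd x := by
  obtain ⟨-, a, ha⟩ := hγ
  rcases bounded_or_eventually_fixed (K := Unit) (σ := fun _ x => side h γ x)
    (he.continuousOn_extend hf) (fun _ => continuous_side h γ) (fun _ => continuous_const)
    (fun _ => ha) with ⟨k, hk⟩ | hev
  · refine absurd (he.bddAbove_image hf (k := k) (a := a) fun q hq hqa => ?_) hu
    have := hk () _ hqa
    rwa [← mem_range_side_iff.1 hq, he.extend_apply] at this
  · filter_upwards [hev] with x hx using hx ()

/-- The heights of a club subset of `Δ_γ` contain club many ordinals, and these meet the club of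
heights that `f` fixes. -/
theorem unbounded_of_eventually_fixed (he : IsPart h e) {γ : Ordinal.{0}} (hγ : Reaches e γ)
    {f : X → LongRay} (hf : ∀ᶠ x in club,
      extend e f (side h γ (LongRay.ofOrd x)) = LongRay.ofOrd x) {C : Set X} (hC : IsClubSet C)
    (hCγ : C ⊆ ray e γ) : ¬ BddAbove (f '' C) := by
  rw [he.isClubSet_iff] at hC
  have h1 : ∀ᶠ x in club, LongRay.ofOrd x ∈ {x | side h γ x ∈ closure (e '' C)} := by
    refine LongRay.eventually_ofOrd_mem (isClosed_closure.preimage (continuous_side h γ)) ?_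
    rw [LongRay.not_bddAbove_iff]
    intro a
    obtain ⟨q, hq, hqa⟩ := hC.2 a
    refine ⟨ht h (e q), ?_, hqa⟩
    rw [mem_ofPred_eq, ← mem_range_side_iff.1 (hCγ hq)]
    exact subset_closure (mem_image_of_mem _ hq)
  refine not_bddAbove_of_eventually ?_
  filter_upwards [h1, hf, eventually_exists_mem_ray hγ] with x hx hfx ⟨q, _, hqx⟩
  refine ⟨q, he.mem_of_mem_closure_image hC.1 (hqx ▸ hx), ?_⟩
  rw [← hfx, ← hqx, he.extend_apply]

theorem ufoLE_ray_of_subset (he : IsPart h e) {γ : Ordinal.{0}} (hγ : Reaches e γ) {C : Set X}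
    (hC : IsClubSet C) (hCγ : C ⊆ ray e γ) : UfoLE (ray e γ) C := fun _ hf hu =>
  he.unbounded_of_eventually_fixed hγ (he.eventually_fixed_of_unbounded hγ hf hu) hC hCγ

/-- The direction given by the side `Δ_γ`. -/
def rayDirection (he : IsPart h e) {γ : Ordinal.{0}} (hγ : Reaches e γ) : Direction X where
  carrier := ray e γ
  isClubSet := he.isClubSet_ray hγ
  equiv_of_subset _ hC hCγ :=
    ⟨fun _ _ hu hb => hu (hb.mono (image_mono hCγ)), he.ufoLE_ray_of_subset hγ hC hCγ⟩

/-- If `δ < γ`, the coordinate with index `δ` separates the two sides: it is constant on `Δ_δ` and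
equal to the height far out on `Δ_γ`. The converse is the upward propagation of unboundedness. -/
theorem ufoLE_ray_iff (he : IsPart h e) {γ δ : Ordinal.{0}} (hγ : Reaches e γ)
    (hδ : Reaches e δ) : UfoLE (ray e γ) (ray e δ) ↔ γ ≤ δ := by
  constructor
  · intro hle
    by_contra hcon
    have hδγ : δ < γ := not_le.1 hcon
    obtain ⟨b, rfl⟩ : ∃ b : β.ToType, (b : Ordinal) = δ :=
      ⟨ToType.mk ⟨δ, hδγ.trans_le hγ.1⟩, by simp⟩
    refine hle (fun q => crd h b (e q)) ((continuous_crd h b).comp he.isOpenEmbedding.continuous)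
      (not_bddAbove_of_eventually ?_) ⟨LongRay.ofOrd (h b), ?_⟩
    · filter_upwards [eventually_exists_mem_ray hγ, eventually_club_gt (h b)]
        with x ⟨q, hq, hqx⟩ hbx
      refine ⟨q, hq, ?_⟩
      rw [hqx, crd_side_of_lt hδγ, max_eq_right (LongRay.ofOrd_le_ofOrd.2 hbx.le)]
    · rintro _ ⟨q, hq, rfl⟩
      dsimp only
      rw [mem_range_side_iff.1 hq, crd_side_of_le le_rfl]
  · intro hγδ f hf hu
    exact he.unbounded_of_eventually_fixed hδ
      (side_eventually_fixed_mono he.injective he.isOpenEmbedding.isOpen_range he.mem_range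
        (he.continuousOn_extend hf) (he.eventually_fixed_of_unbounded hγ hf hu) δ hγδ hδ.1 hδ.2)
      (he.isClubSet_ray hδ) subset_rfl

theorem reaches_coe (he : IsPart h e) (b : β.ToType) : Reaches e (b : Ordinal) := by
  obtain ⟨a, ha⟩ := exists_gt (h b)
  exact ⟨(ToType.mk.symm b).2.le, a, fun x hx => he.mem_range _ (side_notMem_top
    ((LongRay.ofOrd_lt_ofOrd.2 ha).trans_le hx))⟩

/-- A direction that is unbounded below a horizontal line of an octant is equivalent to the
horizontal side of some octant. -/
theorem exists_equiv_ray_of_strip (he : IsPart h e) (D : Direction X)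
    (hD : ∃ (c : β.ToType) (η : OmegaOne), ∀ a, ∃ q ∈ D.carrier,
      crd h c (e q) ≤ LongRay.ofOrd η ∧ LongRay.ofOrd a < ht h (e q)) :
    ∃ c : β.ToType, UfoLE D.carrier (ray e (c : Ordinal)) ∧
      UfoLE (ray e (c : Ordinal)) D.carrier := by
  -- Minimality of `c` says exactly that every coordinate `b < c` escapes along `D`.
  obtain ⟨c, ⟨η₀, hη₀⟩, hmin⟩ := wellFounded_lt.has_min {c : β.ToType | ∃ η : OmegaOne, ∀ a,
    ∃ q ∈ D.carrier, crd h c (e q) ≤ LongRay.ofOrd η ∧ LongRay.ofOrd a < ht h (e q)} hD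
  obtain ⟨η, hη, hcη⟩ : ∃ η, η₀ ≤ η ∧ h c ≤ η := ⟨_, le_max_left _ _, le_max_right _ _⟩
  have hDcl := (he.isClubSet_iff.1 D.isClubSet).1
  have hcont := he.isOpenEmbedding.continuous
  let C₀ : Set X := D.carrier ∩ {q | crd h c (e q) ≤ LongRay.ofOrd η}
  have hC₀ : IsClosed C₀ :=
    hDcl.inter (isClosed_le ((continuous_crd h c).comp hcont) continuous_const)
  -- Only the points of `C₀` in `O_c` itself are kept; the others could lie in earlier octants,
  -- where coordinate `c` is minimal.
  let C : Set X := C₀ ∩ {q | e q = point h c (ht h (e q)) (crd h c (e q))}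
  have hC : IsClosed C := hC₀.inter (isClosed_eq hcont ((continuous_point h c).comp
    (he.continuous_height.prodMk ((continuous_crd h c).comp hcont))))
  have hev : ∀ᶠ x in club, ∃ q ∈ C, ht h (e q) = LongRay.ofOrd x := by
    have hlim := eventually_exists_mem_closure he.injective (D := e '' C₀) (A := Iio c)
      (fun a => by
        obtain ⟨q, hq, hqc, hqa⟩ := hη₀ a
        exact ⟨_, mem_image_of_mem e ⟨hq, hqc.trans (LongRay.ofOrd_le_ofOrd.2 hη)⟩, hqa⟩)
      (fun b hb a => by
        by_contra! hcon
        refine hmin b ⟨a, fun a' => ?_⟩ hb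
        obtain ⟨_, ⟨q, hq, rfl⟩, hqa, hqa'⟩ := hcon a'
        exact ⟨q, hq.1, hqa, hqa'⟩)
    filter_upwards [hlim, eventually_club_gt η] with x ⟨p, hp, hpx, hpb⟩ hηx
    have hpc : crd h c p ≤ LongRay.ofOrd η :=
      closure_minimal (t := {p | crd h c p ≤ LongRay.ofOrd η})
        (by rintro _ ⟨q, hq, rfl⟩; exact hq.2)
        (isClosed_le (continuous_crd h c) continuous_const) hp
    have hlt : crd h c p < ht h p := by
      rw [hpx]
      exact hpc.trans_lt (LongRay.ofOrd_lt_ofOrd.2 hηx)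
    obtain ⟨q, rfl⟩ := he.mem_range p (notMem_top hlt)
    refine ⟨q, ⟨he.mem_of_mem_closure_image hC₀ hp, ?_⟩, hpx⟩
    exact eq_point (fun b hb => hpx ▸ hpb b hb)
      fun d hd => crd_eq_ofOrd_of_lt hd (hlt.trans_le (le_max_right _ _))
  obtain ⟨hCD, hDC⟩ := D.equiv_of_subset C (he.isClubSet_of_eventually hC hev) fun q hq => hq.1.1
  have hηc := LongRay.ofOrd_le_ofOrd.2 hcη
  have hmemC : ∀ q ∈ C, crd h c (e q) ∈ Icc (LongRay.ofOrd (h c)) (LongRay.ofOrd η) :=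
    fun q hq => ⟨le_crd c _, hq.1.2⟩
  -- Both comparisons pass through `C`, on which the strip dichotomy relates `f` to its behaviour on
  -- the lower edge `Δ_c`.
  refine ⟨c, fun f hf hu => ?_, fun f hf hu => hCD f hf ?_⟩
  · rcases strip_bounded_or_eventually_fixed he.mem_range (he.continuousOn_extend hf) c hηc
      with ⟨k, a, hk⟩ | hfix
    · refine absurd (he.bddAbove_image hf (k := k) (a := a) fun q hq hqa => ?_) (hDC f hf hu)
      have := hk _ hqa _ (hmemC q hq)
      rwa [← show e q = _ from hq.2, he.extend_apply] at this
    · refine he.unbounded_of_eventually_fixed (he.reaches_coe c) ?_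
        (he.isClubSet_ray (he.reaches_coe c)) subset_rfl
      filter_upwards [hfix] with x hx
      rw [← point_ofOrd]
      exact hx _ ⟨le_rfl, hηc⟩
  · refine not_bddAbove_of_eventually ?_
    filter_upwards [hev, strip_eventually_fixed he.mem_range (he.continuousOn_extend hf)
      (he.eventually_fixed_of_unbounded (he.reaches_coe c) hf hu) hηc] with x ⟨q, hq, hqx⟩ hx
    refine ⟨q, hq, ?_⟩
    have := hx _ (hmemC q hq)
    rw [← hqx, ← show e q = _ from hq.2, he.extend_apply] at this
    exact this.trans hqx

/-- A direction that is bounded below all horizontal lines is equivalent to the upper side, if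
this is present. -/
theorem equiv_ray_top (he : IsPart h e) (hβ : Reaches e β) (D : Direction X)
    (hD : ∀ (c : β.ToType) (η : OmegaOne), ∃ a, ∀ q ∈ D.carrier,
      crd h c (e q) ≤ LongRay.ofOrd η → ht h (e q) ≤ LongRay.ofOrd a) :
    UfoLE D.carrier (ray e β) ∧ UfoLE (ray e β) D.carrier := by
  obtain ⟨hDcl, hDu⟩ := he.isClubSet_iff.1 D.isClubSet
  -- All coordinates escape, so the limit points found have every coordinate maximal and lie on
  -- `Δ_β`.
  have hlim := eventually_exists_mem_closure he.injective (D := e '' D.carrier) (A := univ)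
    (fun a => by
      obtain ⟨q, hq, hqa⟩ := hDu a
      exact ⟨_, mem_image_of_mem e hq, hqa⟩)
    (fun b _ a => by
      obtain ⟨a', ha'⟩ := hD b a
      exact ⟨a', by rintro _ ⟨q, hq, rfl⟩; exact ha' q hq⟩)
  have hC : IsClubSet (D.carrier ∩ ray e β) := by
    refine he.isClubSet_of_eventually (hDcl.inter (he.isClosed_ray β)) ?_
    filter_upwards [hlim, eventually_exists_mem_ray hβ] with x ⟨p, hp, hpx, hpb⟩ ⟨q, hq, hqx⟩
    obtain rfl : e q = p := by
      rw [hqx]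
      refine ext hpx.symm fun b => ?_
      rw [crd_side_top, hpb b trivial]
    exact ⟨q, ⟨he.mem_of_mem_closure_image hDcl hp, hq⟩, hpx⟩
  obtain ⟨hCD, hDC⟩ := D.equiv_of_subset _ hC inter_subset_left
  exact ⟨fun f hf hu hb => hDC f hf hu (hb.mono (image_mono inter_subset_right)),
    fun f hf hu => hCD f hf (he.ufoLE_ray_of_subset hβ hC inter_subset_right f hf hu)⟩

/-- If the upper side is missing, no direction is bounded below all horizontal lines. -/
theorem not_forall_bounded_of_notMem_top (he : IsPart h e) (hβ : ∀ b : β.ToType, ∃ c, b < c)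
    (htop : ∀ q, e q ∉ range (side h β)) (D : Direction X) :
    ¬ ∀ (c : β.ToType) (η : OmegaOne), ∃ a, ∀ q ∈ D.carrier,
      crd h c (e q) ≤ LongRay.ofOrd η → ht h (e q) ≤ LongRay.ofOrd a := by
  intro hD
  obtain ⟨hDcl, hDu⟩ := he.isClubSet_iff.1 D.isClubSet
  have hcont := he.isOpenEmbedding.continuous
  have : CompletelyRegularSpace (OctantPile h) :=
    (isClosedEmbedding_val h).isInducing.completelyRegularSpace
  have : CompletelyRegularSpace X := he.isOpenEmbedding.isInducing.completelyRegularSpace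
  have : T2Space X := he.isOpenEmbedding.isEmbedding.t2Space
  -- Were the octants starting by height `ξ` cofinal in the pile, a point of `D` above the countably
  -- many bounds `a c` would lie below one of them, where coordinate `c` has its least value `h c ≤
  -- ξ`, contradicting its bound.
  have hbd : ∀ ξ : OmegaOne, ∃ d : β.ToType, ∀ c, h c ≤ ξ → c < d := fun ξ => by
    by_contra! hcon
    choose a ha using fun c => hD c ξ
    obtain ⟨m, hm⟩ := OmegaOne.exists_gt_of_countable
      (((OmegaOne.countable_Iic ξ).preimage he.injective).image a)
    obtain ⟨q, hq, hqm⟩ := hDu m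
    obtain ⟨b, -, hb, -⟩ := exists_crd_lt_of_notMem_top (htop q)
    obtain ⟨b', hb'⟩ := hβ b
    obtain ⟨c, hcξ, hc⟩ := hcon b'
    have h1 := ha c q hq (by
      rw [crd_eq_ofOrd_of_lt (hb'.trans_le hc) (hb.trans_le (le_max_right _ _))]
      exact LongRay.ofOrd_le_ofOrd.2 hcξ)
    exact absurd (h1.trans (LongRay.ofOrd_le_ofOrd.2 (hm _ ⟨c, hcξ, rfl⟩).le)) (not_le.2 hqm)
  choose d hd using hbd
  -- The chosen point lies above `Δ_{d ξ}`, hence above every octant that starts at height at most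
  -- `ξ`.
  have hq : ∀ ξ : OmegaOne, ∃ q ∈ D.carrier, LongRay.ofOrd ξ < ht h (e q) ∧
      LongRay.ofOrd (h (d ξ)) < crd h (d ξ) (e q) := fun ξ => by
    obtain ⟨m, hm⟩ := hD (d ξ) (h (d ξ))
    obtain ⟨q, hqD, hqm⟩ := hDu (max ξ m)
    refine ⟨q, hqD, (LongRay.ofOrd_le_ofOrd.2 (le_max_left _ _)).trans_lt hqm,
      not_le.1 fun hcon => ?_⟩
    exact absurd ((hm q hqD hcon).trans (LongRay.ofOrd_le_ofOrd.2 (le_max_right _ _)))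
      (not_le.2 hqm)
  choose q hqD hqξ hqd using hq
  choose b hb using fun ξ => LongRay.exists_lt_ofOrd (ht h (e (q ξ)))
  let T : Set OmegaOne := {x | ∀ ζ < x, b ζ < x}
  have hT : ∀ᶠ x in club, x ∈ T := eventually_club_closed b
  let s : OmegaOne → OmegaOne := fun a =>
    (wellFounded_lt (α := OmegaOne)).min {x | a < x ∧ x ∈ T} (hT.exists_gt_of_club a)
  have hs : ∀ a, a < s a ∧ s a ∈ T := fun a =>
    (wellFounded_lt (α := OmegaOne)).min_mem {x | a < x ∧ x ∈ T} _
  -- The next-element function `s` of `T` splits `T`: its closure points lie in `T₀`, while each `s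
  -- a` lies outside. Both parts of `T` are unbounded.
  let T₀ : Set OmegaOne := {x | ∀ ζ < x, s ζ < x}
  let U : T → Set X := fun ξ => {x | LongRay.ofOrd (h (d ξ)) < crd h (d ξ) (e x) ∧
    ht h (e x) < LongRay.ofOrd (b ξ)}
  have hU : ∀ ξ, IsOpen (U ξ) := fun ξ =>
    (isOpen_lt continuous_const ((continuous_crd h _).comp hcont)).inter
      (isOpen_lt he.continuous_height continuous_const)
  have hqU : ∀ ξ : T, q ξ ∈ U ξ := fun ξ => ⟨hqd ξ, hb ξ⟩
  have hdisc : ∀ x, ∃ V ∈ 𝓝 x, {ξ : T | (U ξ ∩ V).Nonempty}.Subsingleton := fun x => by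
    obtain ⟨c, hc, hc', -⟩ := exists_crd_lt_of_notMem_top (htop x)
    let V : Set X := {x | LongRay.ofOrd (h c) < ht h (e x) ∧ crd h c (e x) < ht h (e x)}
    have hV : IsOpen V := (isOpen_lt continuous_const he.continuous_height).inter
      (isOpen_lt ((continuous_crd h c).comp hcont) he.continuous_height)
    -- If `V` meets `U ξ`, then `O_c` starts before `b ξ < ξ'`. Points of `U ξ'` are therefore above
    -- `O_c`, whereas points of `V` are strictly below its diagonal.
    have key : ∀ ξ ξ' : T, (U ξ ∩ V).Nonempty → (U ξ' ∩ V).Nonempty → ¬ ξ < ξ' := by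
      rintro ξ ξ' ⟨y, hyU, hyV⟩ ⟨z, hzU, hzV⟩ hlt
      have h1 : h c < b ξ := LongRay.ofOrd_lt_ofOrd.1 (hyV.1.trans hyU.2)
      have h2 : c < d ξ' := hd ξ' c (h1.trans (ξ'.2 ξ hlt)).le
      exact hzU.1.ne' (crd_eq_ofOrd_of_lt h2 (hzV.2.trans_le (le_max_right _ _)))
    exact ⟨V, hV.mem_nhds ⟨hc, hc'⟩, fun ξ hξ ξ' hξ' =>
      le_antisymm (not_lt.1 (key ξ' ξ hξ' hξ)) (not_lt.1 (key ξ ξ' hξ hξ'))⟩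
  classical
  obtain ⟨f, hf, hfq⟩ := exists_continuous_longRay_of_discrete hU hqU hdisc
    fun ξ => if (ξ : OmegaOne) ∈ T₀ then LongRay.ofOrd ξ else ⊥
  let C : Set X := (fun ξ : T => q ξ) '' {ξ | (ξ : OmegaOne) ∉ T₀}
  have hC : IsClubSet C := he.isClubSet_iff.2 ⟨isClosed_image_of_discrete hqU hdisc _, fun a =>
    ⟨q (s a), ⟨⟨s a, (hs a).2⟩, fun hcon => lt_irrefl _ (hcon a (hs a).1), rfl⟩,
      (LongRay.ofOrd_lt_ofOrd.2 (hs a).1).trans (hqξ _)⟩⟩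
  have hCD : C ⊆ D.carrier := by
    rintro _ ⟨ξ, -, rfl⟩
    exact hqD ξ
  -- The function is unbounded on the points indexed by `T ∩ T₀`, but zero on the club subset `C`
  -- indexed by the rest of `T`.
  refine (D.equiv_of_subset C hC hCD).2 f hf (not_bddAbove_of_eventually ?_) ⟨⊥, ?_⟩
  · filter_upwards [hT, eventually_club_closed s] with x hxT hxs
    exact ⟨q x, hqD x, (hfq ⟨x, hxT⟩).trans (if_pos hxs)⟩
  · rintro _ ⟨_, ⟨ξ, hξ, rfl⟩, rfl⟩
    exact ((hfq ξ).trans (if_neg hξ)).le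

/-- The poset of directions of a part of the pile is the ordinal of all the sides in it. -/
theorem nonempty_directionClass_orderIso (he : IsPart h e)
    (htop : Reaches e β ∨ ((∀ b : β.ToType, ∃ c, b < c) ∧ ∀ q, e q ∉ range (side h β)))
    {α : Ordinal.{0}} (hα : ∀ γ, Reaches e γ ↔ γ < α) :
    Nonempty (DirectionClass X ≃o α.ToType) := by
  have hα' : ∀ γ : α.ToType, Reaches e (γ : Ordinal) := fun γ => (hα _).2 (ToType.mk.symm γ).2
  let Φ : α.ToType → DirectionClass X := fun γ =>
    toAntisymmetrization (· ≤ ·) (he.rayDirection (hα' γ))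
  have hΦ : ∀ γ δ, Φ γ ≤ Φ δ ↔ γ ≤ δ := fun γ δ => by
    rw [toAntisymmetrization_le_toAntisymmetrization_iff]
    exact (he.ufoLE_ray_iff (hα' γ) (hα' δ)).trans (by simp)
  have hsurj : Function.Surjective Φ := fun x => by
    induction x using Antisymmetrization.ind with
    | _ D =>
    have hex : ∃ γ, Reaches e γ ∧ UfoLE D.carrier (ray e γ) ∧ UfoLE (ray e γ) D.carrier := by
      by_cases hD : ∀ (c : β.ToType) (η : OmegaOne), ∃ a, ∀ q ∈ D.carrier,
          crd h c (e q) ≤ LongRay.ofOrd η → ht h (e q) ≤ LongRay.ofOrd a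
      · rcases htop with hβ | ⟨hβ, hβ'⟩
        · exact ⟨β, hβ, he.equiv_ray_top hβ D hD⟩
        · exact absurd hD (he.not_forall_bounded_of_notMem_top hβ hβ' D)
      · push Not at hD
        obtain ⟨c, hc⟩ := he.exists_equiv_ray_of_strip D hD
        exact ⟨_, he.reaches_coe c, hc⟩
    obtain ⟨γ, hγ, h1, h2⟩ := hex
    obtain ⟨g, rfl⟩ : ∃ g : α.ToType, (g : Ordinal) = γ :=
      ⟨ToType.mk ⟨γ, (hα γ).1 hγ⟩, by simp⟩
    refine ⟨g, Quotient.sound ⟨h2, h1⟩⟩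
  exact ⟨(OrderIso.symm ⟨Equiv.ofBijective Φ ⟨fun γ δ hγδ =>
    le_antisymm ((hΦ _ _).1 hγδ.le) ((hΦ _ _).1 hγδ.ge), hsurj⟩, fun {γ δ} => hΦ γ δ⟩)⟩

end IsPart

end OctantPile

/-! ### Local models of surfaces with boundary -/

section LocalModels

theorem exists_isOpenEmbedding_real {c ε : ℝ} (hε : 0 < ε) :
    ∃ σ : ℝ → ℝ, IsOpenEmbedding σ ∧ c ∈ range σ ∧ range σ ⊆ Metric.ball c ε := by
  let P := OpenPartialHomeomorph.univBall c ε (E := ℝ)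
  have hr : range P = Metric.ball c ε := by
    rw [← image_univ, ← OpenPartialHomeomorph.univBall_source c ε, P.image_source_eq_target,
      OpenPartialHomeomorph.univBall_target c hε]
  refine ⟨P, P.isOpenEmbedding (OpenPartialHomeomorph.univBall_source c ε), ?_, hr.le⟩
  rw [hr]
  exact Metric.mem_ball_self hε

theorem exists_isOpenEmbedding_Ici_of_pos {c : Ici (0 : ℝ)} (hc : 0 < (c : ℝ)) {ε : ℝ}
    (hε : 0 < ε) :
    ∃ σ : ℝ → Ici (0 : ℝ), IsOpenEmbedding σ ∧ c ∈ range σ ∧ range σ ⊆ Metric.ball c ε := by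
  obtain ⟨σ, hσ, ⟨s, hs⟩, hσr⟩ := exists_isOpenEmbedding_real (c := c) (lt_min hε hc)
  have hmem : ∀ t, σ t ∈ Ici (0 : ℝ) := fun t => by
    have h1 := hσr (mem_range_self t)
    rw [Metric.mem_ball, Real.dist_eq] at h1
    have h2 := (abs_lt.1 (h1.trans_le (min_le_right _ _))).1
    exact mem_Ici.2 (by linarith)
  refine ⟨codRestrict σ (Ici 0) hmem, ⟨hσ.isEmbedding.codRestrict _ _, ?_⟩,
    ⟨s, Subtype.ext hs⟩, ?_⟩
  · have : range (codRestrict σ (Ici 0) hmem) = Subtype.val ⁻¹' range σ := by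
      ext t
      simp
    rw [this]
    exact hσ.isOpen_range.preimage continuous_subtype_val
  · rintro _ ⟨t, rfl⟩
    have h1 := hσr (mem_range_self t)
    rw [Metric.mem_ball] at h1
    exact h1.trans_le (min_le_left _ _)

theorem exists_isOpenEmbedding_Ici_zero {c : Ici (0 : ℝ)} (hc : (c : ℝ) = 0) {ε : ℝ}
    (hε : 0 < ε) :
    ∃ σ : Ici (0 : ℝ) → Ici (0 : ℝ), IsOpenEmbedding σ ∧ c ∈ range σ ∧
      range σ ⊆ Metric.ball c ε := by
  have hnn : ∀ s : Ici (0 : ℝ), 0 ≤ (s : ℝ) := fun s => s.2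
  -- The map `s ↦ ε s / (1 + s)` compresses `[0, ∞)` onto `[0, ε)` and keeps the boundary point.
  let σ : Ici (0 : ℝ) → Ici (0 : ℝ) := fun s =>
    ⟨ε * s / (1 + s), by have := hnn s; exact mem_Ici.2 (by positivity)⟩
  have hmono : StrictMono σ := fun s t hst => by
    have h1 := hnn s
    have h2 := hnn t
    have h3 : (s : ℝ) < t := hst
    change ε * s / (1 + s) < ε * t / (1 + t)
    rw [div_lt_div_iff₀ (by positivity) (by positivity)]
    nlinarith
  have hr : range σ = {t : Ici (0 : ℝ) | (t : ℝ) < ε} := by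
    ext t
    constructor
    · rintro ⟨s, rfl⟩
      have h1 := hnn s
      change ε * s / (1 + s) < ε
      rw [div_lt_iff₀ (by positivity)]
      nlinarith
    · intro ht
      have ht' : (t : ℝ) < ε := ht
      have h1 := hnn t
      have h2 : 0 < ε - t := sub_pos.2 ht'
      refine ⟨⟨t / (ε - t), mem_Ici.2 (by positivity)⟩, Subtype.ext ?_⟩
      change ε * (t / (ε - t)) / (1 + t / (ε - t)) = t
      field_simp
      ring
  have ho : IsOpen (range σ) := by
    rw [hr]
    exact isOpen_lt continuous_subtype_val continuous_const
  refine ⟨σ, ⟨hmono.isEmbedding_of_ordConnected ?_, ho⟩, ?_, ?_⟩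
  · rw [hr]
    exact ⟨fun x _ y hy z hz => (show (z : ℝ) ≤ y from hz.2).trans_lt hy⟩
  · rw [hr]
    change (c : ℝ) < ε
    rwa [hc]
  · rw [hr]
    intro t ht
    have h1 : dist t c = |(t : ℝ) - c| := rfl
    have h2 : (t : ℝ) - c = t := by linarith
    rw [Metric.mem_ball, h1, h2, abs_of_nonneg (hnn t)]
    exact ht

/-- Open subsets of the half-plane are surfaces with boundary. -/
theorem exists_chart_halfPlane {O : Set (ℝ × Ici (0 : ℝ))} (hO : IsOpen O) {z : ℝ × Ici (0 : ℝ)}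
    (hz : z ∈ O) :
    (∃ j : ℝ × ℝ → ℝ × Ici (0 : ℝ), IsOpenEmbedding j ∧ z ∈ range j ∧ range j ⊆ O) ∨
    ∃ j : ℝ × Ici (0 : ℝ) → ℝ × Ici (0 : ℝ), IsOpenEmbedding j ∧ z ∈ range j ∧ range j ⊆ O := by
  obtain ⟨ε, hε, hεO⟩ := Metric.isOpen_iff.1 hO z hz
  obtain ⟨σ, hσ, hσz, hσr⟩ := exists_isOpenEmbedding_real (c := z.1) hε
  have key : ∀ {M : Type} [TopologicalSpace M] (τ : M → Ici (0 : ℝ)), IsOpenEmbedding τ →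
      z.2 ∈ range τ → range τ ⊆ Metric.ball z.2 ε → IsOpenEmbedding (Prod.map σ τ) ∧
      z ∈ range (Prod.map σ τ) ∧ range (Prod.map σ τ) ⊆ O := by
    intro M _ τ hτ hτz hτr
    refine ⟨hσ.prodMap hτ, ?_, ?_⟩
    · rw [range_prodMap]
      exact ⟨hσz, hτz⟩
    · rw [range_prodMap]
      refine (prod_mono hσr hτr).trans ?_
      rwa [ball_prod_same]
  rcases (show (0 : ℝ) ≤ z.2 from z.2.2).eq_or_lt with h0 | h0
  · obtain ⟨τ, hτ, hτz, hτr⟩ := exists_isOpenEmbedding_Ici_zero h0.symm hε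
    exact Or.inr ⟨_, key τ hτ hτz hτr⟩
  · obtain ⟨τ, hτ, hτz, hτr⟩ := exists_isOpenEmbedding_Ici_of_pos h0 hε
    exact Or.inl ⟨_, key τ hτ hτz hτr⟩

theorem coe_min_Ici (a b : Ici (0 : ℝ)) : ((min a b : Ici (0 : ℝ)) : ℝ) = min (a : ℝ) b := by
  rcases le_total a b with hab | hab
  · rw [min_eq_left hab, min_eq_left (show (a : ℝ) ≤ b from hab)]
  · rw [min_eq_right hab, min_eq_right (show (b : ℝ) ≤ a from hab)]

/-- The quadrant is homeomorphic to the half-plane. -/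
def quadrantHomeomorph : Ici (0 : ℝ) × Ici (0 : ℝ) ≃ₜ ℝ × Ici (0 : ℝ) where
  toFun q := (q.1 - q.2, min q.1 q.2)
  invFun q := (⟨q.2 + max q.1 0, mem_Ici.2 (add_nonneg (mem_Ici.1 q.2.2) (le_max_right _ _))⟩,
    ⟨q.2 + max (-q.1) 0, mem_Ici.2 (add_nonneg (mem_Ici.1 q.2.2) (le_max_right _ _))⟩)
  left_inv := by
    rintro ⟨a, b⟩
    rcases le_total a b with hab | hab
    · have : (a : ℝ) ≤ b := hab
      refine Prod.ext (Subtype.ext ?_) (Subtype.ext ?_)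
      · simp [hab]
      · simp [hab]
    · have : (b : ℝ) ≤ a := hab
      refine Prod.ext (Subtype.ext ?_) (Subtype.ext ?_)
      · simp [hab]
      · simp [hab]
  right_inv := by
    rintro ⟨d, m⟩
    rcases le_total d 0 with hd | hd
    · refine Prod.ext ?_ (Subtype.ext ?_)
      · simp [hd]
      · change ((min (_ : Ici (0 : ℝ)) _ : Ici (0 : ℝ)) : ℝ) = m
        rw [coe_min_Ici]
        simp [hd]
    · refine Prod.ext ?_ (Subtype.ext ?_)
      · simp [hd]
      · change ((min (_ : Ici (0 : ℝ)) _ : Ici (0 : ℝ)) : ℝ) = m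
        rw [coe_min_Ici]
        simp [hd]
  continuous_toFun := by fun_prop
  continuous_invFun := by fun_prop

/-- A point with an open neighbourhood that embeds as an open subset of the quadrant has a chart. -/
theorem exists_chart_of_quadrant {X : Type} [TopologicalSpace X] {V : Set X} (hV : IsOpen V)
    {k : V → Ici (0 : ℝ) × Ici (0 : ℝ)} (hk : IsOpenEmbedding k) {x : X} (hx : x ∈ V) :
    ∃ U : Set X, IsOpen U ∧ x ∈ U ∧
      (Nonempty (U ≃ₜ ℝ × ℝ) ∨ Nonempty (U ≃ₜ ℝ × Ici (0 : ℝ))) := by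
  have hk' := quadrantHomeomorph.isOpenEmbedding.comp hk
  have key : ∀ {M : Type} [TopologicalSpace M] (j : M → ℝ × Ici (0 : ℝ)), IsOpenEmbedding j →
      (quadrantHomeomorph ∘ k) ⟨x, hx⟩ ∈ range j → range j ⊆ range (quadrantHomeomorph ∘ k) →
      ∃ U : Set X, IsOpen U ∧ x ∈ U ∧ Nonempty (U ≃ₜ M) := by
    intro M _ j hj hjx hjr
    choose l hl using fun m => hjr (mem_range_self m)
    have hl' : IsOpenEmbedding l := IsOpenEmbedding.of_comp l hk' (by
      rwa [show (quadrantHomeomorph ∘ k) ∘ l = j from funext hl])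
    have hL : IsOpenEmbedding (Subtype.val ∘ l) := hV.isOpenEmbedding_subtypeVal.comp hl'
    refine ⟨range (Subtype.val ∘ l), hL.isOpen_range, ?_, ⟨hL.isEmbedding.toHomeomorph.symm⟩⟩
    obtain ⟨m, hm⟩ := hjx
    refine ⟨m, ?_⟩
    have : l m = ⟨x, hx⟩ := hk'.injective ((hl m).trans hm)
    simp [this]
  rcases exists_chart_halfPlane hk'.isOpen_range (mem_range_self ⟨x, hx⟩) with
    ⟨j, hj, hjx, hjr⟩ | ⟨j, hj, hjx, hjr⟩
  · obtain ⟨U, hU, hxU, hUM⟩ := key j hj hjx hjr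
    exact ⟨U, hU, hxU, Or.inl hUM⟩
  · obtain ⟨U, hU, hxU, hUM⟩ := key j hj hjx hjr
    exact ⟨U, hU, hxU, Or.inr hUM⟩

/-- A continuous map on a compact set restricts to an open embedding on an open part where it is
injective, if this part is mapped into an open subset of the image. -/
theorem isOpenEmbedding_comp_of_isCompact {X Y Z : Type*} [TopologicalSpace X]
    [TopologicalSpace Y] [TopologicalSpace Z] [T2Space Y] {Φ : X → Y} (hΦ : Continuous Φ)
    {e : Z → X} (he : IsOpenEmbedding e) {K : Set X} (hK : IsCompact K) (heK : ∀ z, e z ∈ K)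
    {W : Set Y} (hW : IsOpen W) (heW : ∀ z, Φ (e z) ∈ W)
    (hinj : ∀ z, ∀ p ∈ K, Φ (e z) = Φ p → e z = p)
    (hsurj : ∀ y ∈ W, ∃ p ∈ K, Φ p = y) : IsOpenEmbedding (Φ ∘ e) := by
  refine IsOpenEmbedding.of_continuous_injective_isOpenMap (hΦ.comp he.continuous)
    (fun z z' hz => he.injective (hinj z _ (heK z') hz)) fun O hO => ?_
  -- Injectivity separates the image of `O` from that of the compact set `K \ e '' O`, and the
  -- latter image is closed.
  have : (Φ ∘ e) '' O = W ∩ (Φ '' (K \ e '' O))ᶜ := by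
    ext y
    constructor
    · rintro ⟨z, hz, rfl⟩
      refine ⟨heW z, ?_⟩
      rintro ⟨p, ⟨hpK, hpO⟩, hp⟩
      exact hpO (hinj z p hpK hp.symm ▸ mem_image_of_mem e hz)
    · rintro ⟨hyW, hy⟩
      obtain ⟨p, hpK, rfl⟩ := hsurj y hyW
      by_contra hcon
      refine hy ⟨p, ⟨hpK, ?_⟩, rfl⟩
      rintro ⟨z, hz, rfl⟩
      exact hcon ⟨z, hz, rfl⟩
  rw [this]
  exact hW.inter ((hK.diff (he.isOpenMap _ hO)).image hΦ).isClosed.isOpen_compl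

end LocalModels

/-! ### The part of a pile below a given height is planar -/

namespace OctantPile

variable {β : Ordinal.{0}} {h : β.ToType → OmegaOne}

variable (h) in
/-- Some octant is present at the height of the point, or the pile begins with an octant. -/
def IsSolid (p : OctantPile h) : Prop := ∃ b, h b = ⊥ ∨ LongRay.ofOrd (h b) < ht h p

theorem IsSolid.exists_lt {p : OctantPile h} (hp : IsSolid h p) {y : LongRay} (hy : ht h p < y) :
    ∃ b, LongRay.ofOrd (h b) < y := by
  obtain ⟨b, hb | hb⟩ := hp
  · exact ⟨b, by rw [hb]; exact bot_le.trans_lt hy⟩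
  · exact ⟨b, hb.trans hy⟩

variable (h) in
/-- A map from the pile to the quadrant that is injective on the solid part up to height `ξ`; it
sends the upper side to a side of the quadrant. -/
structure QuadrantMap (ξ : OmegaOne) where
  /-- the underlying map -/
  toFun : OctantPile h → Ici (0 : ℝ) × Ici (0 : ℝ)
  /-- the image of the part of height less than `ξ` is the part of the quadrant where the sum of the
  coordinates is less than this bound -/
  bound : ℝ
  continuous_toFun : Continuous toFun
  fst_top : ∀ x, ((toFun (side h β x)).1 : ℝ) = 0
  fst_pos : ∀ p ∉ range (side h β), ht h p < LongRay.ofOrd ξ → 0 < ((toFun p).1 : ℝ)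
  add_lt : ∀ p, IsSolid h p → ht h p < LongRay.ofOrd ξ →
    ((toFun p).1 : ℝ) + (toFun p).2 < bound
  injOn : ∀ p q, IsSolid h p → ht h p ≤ LongRay.ofOrd ξ → ht h q ≤ LongRay.ofOrd ξ →
    toFun p = toFun q → p = q
  exists_eq : ∀ z : Ici (0 : ℝ) × Ici (0 : ℝ), (z.1 : ℝ) + z.2 < bound →
    ∃ p, ht h p < LongRay.ofOrd ξ ∧ toFun p = z

/-- Distinct points at the same height are comparable. -/
theorem crd_le_crd_of_lt {p q : OctantPile h} (hpq : ht h p = ht h q) {b : β.ToType}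
    (hb : crd h b p < crd h b q) (c : β.ToType) : crd h c p ≤ crd h c q := by
  rcases lt_trichotomy c b with hc | rfl | hc
  · rw [crd_eq_of_lt hc ((le_crd b p).trans_lt hb), ← hpq]
    exact crd_le c p
  · exact hb.le
  · rw [crd_eq_ofOrd_of_lt hc (hb.trans_le (hpq ▸ crd_le b q))]
    exact le_crd c q

/-- In each slice of fixed height, `lo` and `hi` are weighted distances to the lower and the upper
side. Their sum `G` depends only on the height and increases strictly once an octant is present. The
sum thus recovers the height, and `lo` recovers the point, since slices are linearly ordered. -/
theorem nonempty_quadrantMap (hh : Function.Injective h) (ξ : OmegaOne) :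
    Nonempty (QuadrantMap h ξ) := by
  obtain ⟨φ, hφ, hmono, hstrict, hbd, himg⟩ := LongRay.exists_real_chart ξ
  -- Positive weight goes exactly to the octants starting below `ξ`, countably many by injectivity
  -- of `h`.
  obtain ⟨w, hw, hpos, hs⟩ := ((OmegaOne.countable_Iio ξ).preimage hh).exists_summable_weight
  replace hpos : ∀ b, 0 < w b ↔ h b < ξ := hpos
  set T := φ (LongRay.ofOrd ξ)
  have hbound : ∀ b u v, ‖w b * (φ u - φ v)‖ ≤ w b * T := fun b u v => by
    rw [norm_mul, Real.norm_of_nonneg (hw b), Real.norm_eq_abs]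
    refine mul_le_mul_of_nonneg_left (abs_sub_le_iff.2 ⟨?_, ?_⟩) (hw b)
    · linarith [(hbd u).2, (hbd v).1]
    · linarith [(hbd v).2, (hbd u).1]
  have hsum : ∀ u v : β.ToType → LongRay, Summable fun b => w b * (φ (u b) - φ (v b)) := fun u v =>
    Summable.of_norm_bounded (hs.mul_right T) fun b => hbound b _ _
  have hcont : ∀ {Y : Type} [TopologicalSpace Y] (u v : β.ToType → Y → LongRay),
      (∀ b, Continuous (u b)) → (∀ b, Continuous (v b)) →
      Continuous fun y => ∑' b, w b * (φ (u b y) - φ (v b y)) := fun u v hu hv =>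
    continuous_tsum (fun b => continuous_const.mul ((hφ.comp (hu b)).sub (hφ.comp (hv b))))
      (hs.mul_right T) fun b y => hbound b _ _
  have hnn : ∀ u v : β.ToType → LongRay, (∀ b, v b ≤ u b) →
      0 ≤ ∑' b, w b * (φ (u b) - φ (v b)) := fun u v huv =>
    tsum_nonneg fun b => mul_nonneg (hw b) (sub_nonneg.2 (hmono (huv b)))
  -- strict monotonicity of the sums
  have hlt : ∀ (u v v' : β.ToType → LongRay) (b : β.ToType), (∀ c, u c ≤ v c) → u b < v b →
      v b ≤ LongRay.ofOrd ξ → h b < ξ →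
      ∑' c, w c * (φ (u c) - φ (v' c)) < ∑' c, w c * (φ (v c) - φ (v' c)) := by
    intro u v v' b huv hb hbξ hhb
    refine Summable.tsum_lt_tsum (i := b) (fun c => ?_) ?_ (hsum _ _) (hsum _ _)
    · exact mul_le_mul_of_nonneg_left (sub_le_sub_right (hmono (huv c)) _) (hw c)
    · exact mul_lt_mul_of_pos_left (sub_lt_sub_right
        (hstrict (hb.le.trans hbξ) hbξ hb) _) ((hpos b).2 hhb)
  let ℓ : β.ToType → LongRay := fun b => LongRay.ofOrd (h b)
  let lo : OctantPile h → ℝ := fun p => ∑' b, w b * (φ (crd h b p) - φ (ℓ b))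
  let hi : OctantPile h → ℝ := fun p => ∑' b, w b * (φ (max (ℓ b) (ht h p)) - φ (crd h b p))
  let G : LongRay → ℝ := fun x => ∑' b, w b * (φ (max (ℓ b) x) - φ (ℓ b))
  have hadd : ∀ p, hi p + lo p = G (ht h p) := fun p => by
    simp only [hi, lo, G]
    rw [← Summable.tsum_add (hsum _ _) (hsum _ _)]
    exact tsum_congr fun b => by ring
  have hlo0 : ∀ p, 0 ≤ lo p := fun p => hnn _ _ fun b => le_crd b p
  have hhi0 : ∀ p, 0 ≤ hi p := fun p => hnn _ _ fun b => crd_le b p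
  have hG : ∀ x y, x < y → y ≤ LongRay.ofOrd ξ → (∃ b, ℓ b < y) → G x < G y := by
    rintro x y hxy hyξ ⟨b, hb⟩
    refine hlt _ _ _ b (fun c => max_le_max le_rfl hxy.le) ?_ (max_le (hb.le.trans hyξ) hyξ)
      (LongRay.ofOrd_lt_ofOrd.1 (hb.trans_le hyξ))
    rw [max_eq_right hb.le]
    exact max_lt hb hxy
  have hGc : Continuous G := hcont _ _ (fun b => continuous_const.max continuous_id)
    fun b => continuous_const
  have hG0 : G ⊥ = 0 := by simp [G]
  -- fibres of the height are linearly ordered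
  have hfib : ∀ p q, ht h p = ht h q → ht h q ≤ LongRay.ofOrd ξ → lo p = lo q →
      ∀ b, ¬ crd h b p < crd h b q := by
    intro p q hpq hq hlo b hb
    have h1 : crd h b q ≤ max (ℓ b) (ht h q) := crd_le b q
    have h2 : ℓ b < max (ℓ b) (ht h q) := ((le_crd b p).trans_lt hb).trans_le h1
    have h3 : ℓ b < ht h q := (lt_max_iff.1 h2).resolve_left (lt_irrefl _)
    rw [max_eq_right h3.le] at h1
    exact (hlt _ _ ℓ b (crd_le_crd_of_lt hpq hb) hb (h1.trans hq)
      (LongRay.ofOrd_lt_ofOrd.1 (h3.trans_le hq))).ne hlo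
  refine ⟨⟨fun p => (⟨hi p, mem_Ici.2 (hhi0 p)⟩, ⟨lo p, mem_Ici.2 (hlo0 p)⟩), G (LongRay.ofOrd ξ),
    ?_, ?_, ?_, ?_, ?_, ?_⟩⟩
  · refine (Continuous.subtype_mk ?_ _).prodMk (Continuous.subtype_mk ?_ _)
    · exact hcont _ _ (fun b => continuous_const.max (continuous_ht h)) (continuous_crd h)
    · exact hcont _ _ (continuous_crd h) fun b => continuous_const
  · intro x
    simp [hi, crd_side_top, ℓ]
  · intro p hp hpξ
    obtain ⟨b, hb, hb', -⟩ := exists_crd_lt_of_notMem_top hp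
    have := hlt (fun c => crd h c p) (fun c => max (ℓ c) (ht h p)) (fun c => crd h c p) b
      (fun c => crd_le c p) (hb'.trans_le (le_max_right _ _)) (max_le (hb.trans hpξ).le hpξ.le)
      (LongRay.ofOrd_lt_ofOrd.1 (hb.trans hpξ))
    simpa using this
  · intro p hp hpξ
    change hi p + lo p < _
    rw [hadd]
    exact hG _ _ hpξ le_rfl (hp.exists_lt hpξ)
  · intro p q hp hpξ hqξ hpq
    have h1 : hi p = hi q := congrArg (fun z : Ici (0 : ℝ) × Ici (0 : ℝ) => (z.1 : ℝ)) hpq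
    have h2 : lo p = lo q := congrArg (fun z : Ici (0 : ℝ) × Ici (0 : ℝ) => (z.2 : ℝ)) hpq
    have h3 : G (ht h p) = G (ht h q) := by rw [← hadd, ← hadd, h1, h2]
    have hht : ht h p = ht h q := by
      rcases lt_trichotomy (ht h p) (ht h q) with hlt' | heq | hlt'
      · exact absurd h3 (hG _ _ hlt' hqξ (hp.exists_lt hlt')).ne
      · exact heq
      · refine absurd h3.symm (hG _ _ hlt' hpξ ?_).ne
        obtain ⟨b, hb | hb⟩ := hp
        · exact ⟨b, by simp only [ℓ, hb]; exact bot_le.trans_lt hlt'⟩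
        · exact ⟨b, hb⟩
    refine ext hht fun b => le_antisymm (not_lt.1 ?_) (not_lt.1 ?_)
    · exact hfib q p hht.symm hpξ h2.symm b
    · exact hfib p q hht hqξ h2 b
  · rintro ⟨⟨a, ha⟩, ⟨t, ht0⟩⟩ (hat : a + t < _)
    rw [mem_Ici] at ha ht0
    have := LongRay.preconnectedSpace_Icc (bot_le (a := LongRay.ofOrd ξ))
    -- The height is found by the intermediate value theorem for `G`; it remains to realize the
    -- value `t` of `lo` in that slice.
    obtain ⟨x, hx, hGx⟩ := (isPreconnected_iff_preconnectedSpace.2 this).intermediate_value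
      (left_mem_Icc.2 bot_le) (right_mem_Icc.2 bot_le) hGc.continuousOn
      (show a + t ∈ Icc (G ⊥) (G (LongRay.ofOrd ξ)) from ⟨by rw [hG0]; positivity, hat.le⟩)
    have hxξ : x < LongRay.ofOrd ξ := lt_of_le_of_ne hx.2 fun hcon => by
      rw [hcon] at hGx
      exact hat.ne hGx.symm
    suffices hp : ∃ p, ht h p = x ∧ lo p = t by
      obtain ⟨p, rfl, hp⟩ := hp
      refine ⟨p, hxξ, Prod.ext (Subtype.ext ?_) (Subtype.ext hp)⟩
      have := hadd p
      change hi p = a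
      linarith
    let m : β.ToType → ℝ := fun b => w b * (φ (max (ℓ b) x) - φ (ℓ b))
    have hm : ∀ b, 0 ≤ m b := fun b =>
      mul_nonneg (hw b) (sub_nonneg.2 (hmono (le_max_left _ _)))
    have hms : Summable m := hsum _ _
    have htG : t ≤ ∑' b, m b := by
      change t ≤ G x
      linarith
    rcases htG.eq_or_lt with htop | htop
    · refine ⟨side h β x, rfl, ?_⟩
      rw [htop]
      exact tsum_congr fun b => by rw [crd_side_top]
    -- The octant `O_i` is the one in whose segment the accumulated length passes `t`; the remainder
    -- `t - P` fixes the position inside it.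
    · obtain ⟨i, hi₁, hi₂⟩ := exists_partial_sum_le_lt hm hms ht0 htop
      set P := ∑' c, (Iio i).indicator m c
      have hmi : 0 < m i := by linarith
      have hwi : 0 < w i := (hw i).lt_of_ne fun hcon => by
        simp [m, ← hcon] at hmi
      have hle : ℓ i ≤ max (ℓ i) x := le_max_left _ _
      have := LongRay.preconnectedSpace_Icc hle
      obtain ⟨y, hy, hφy⟩ := (isPreconnected_iff_preconnectedSpace.2 this).intermediate_value
        (left_mem_Icc.2 hle) (right_mem_Icc.2 hle) hφ.continuousOn
        (show φ (ℓ i) + (t - P) / w i ∈ Icc (φ (ℓ i)) (φ (max (ℓ i) x)) from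
          ⟨le_add_of_nonneg_right (div_nonneg (sub_nonneg.2 hi₁) hwi.le), by
            have h1 : (t - P) / w i ≤ φ (max (ℓ i) x) - φ (ℓ i) := by
              rw [div_le_iff₀ hwi]
              have h2 : m i = w i * (φ (max (ℓ i) x) - φ (ℓ i)) := rfl
              linarith
            linarith⟩)
      refine ⟨point h i x y, rfl, ?_⟩
      have hself : crd h i (point h i x y) = y := by
        rw [crd_point_self, max_min_distrib_left, max_eq_right hy.1, min_eq_left hy.2]
      have hdec : ∀ c, w c * (φ (crd h c (point h i x y)) - φ (ℓ c)) =
          (Iio i).indicator m c + if c = i then t - P else 0 := fun c => by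
        rcases lt_trichotomy c i with hc | rfl | hc
        · rw [crd_point_of_lt hc, indicator_of_mem (mem_Iio.2 hc), if_neg hc.ne, add_zero]
        · rw [hself, hφy, indicator_of_notMem (by simp), if_pos rfl]
          field_simp
          ring
        · rw [crd_point_of_gt hc, indicator_of_notMem (by simp [hc.le]), if_neg hc.ne']
          simp [ℓ]
      simp only [lo, hdec]
      rw [Summable.tsum_add (hms.indicator _) (summable_of_hasFiniteSupport
        ((finite_singleton i).subset fun c hc => by
          by_contra hci
          exact hc (if_neg hci))), tsum_ite_eq]
      change P + (t - P) = t
      ring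

/-! ### Parts of the pile are surfaces -/

variable {X : Type} [TopologicalSpace X] {e : X → OctantPile h}

theorem QuadrantMap.isOpenEmbedding {ξ : OmegaOne} (Φ : QuadrantMap h ξ) (he : IsOpenEmbedding e)
    (hsolid : ∀ q, IsSolid h (e q)) :
    IsOpenEmbedding fun q : {q | ht h (e q) < LongRay.ofOrd ξ} => Φ.toFun (e q) := by
  have hopen : IsOpen {q | ht h (e q) < LongRay.ofOrd ξ} :=
    isOpen_lt ((continuous_ht h).comp he.continuous) continuous_const
  have he' := he.comp hopen.isOpenEmbedding_subtypeVal
  have hWo : IsOpen {z : Ici (0 : ℝ) × Ici (0 : ℝ) | (z.1 : ℝ) + z.2 < Φ.bound} :=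
    isOpen_lt (by fun_prop) continuous_const
  have hW : ∀ q : {q | ht h (e q) < LongRay.ofOrd ξ},
      Φ.toFun (e q) ∈ {z : Ici (0 : ℝ) × Ici (0 : ℝ) | (z.1 : ℝ) + z.2 < Φ.bound} :=
    fun q => Φ.add_lt _ (hsolid q) q.2
  exact isOpenEmbedding_comp_of_isCompact Φ.continuous_toFun he'
    (isCompact_ht_le h (LongRay.ofOrd ξ)) (fun q => (show ht h (e q) < _ from q.2).le) hWo hW
    (fun q p hp hqp => Φ.injOn _ _ (hsolid q) (le_of_lt q.2) hp hqp)
    (fun z hz => by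
      obtain ⟨p, hp, hpz⟩ := Φ.exists_eq z hz
      exact ⟨p, hp.le, hpz⟩)

/-- The image in the plane is a triangle, with or without the side corresponding to `Δ_β`, hence
convex. -/
theorem QuadrantMap.isPreconnected {ξ : OmegaOne} (Φ : QuadrantMap h ξ) (he : IsOpenEmbedding e)
    (hsolid : ∀ q, IsSolid h (e q))
    (hr : range e = Set.univ ∨ range e = (range (side h β))ᶜ) :
    IsPreconnected {q | ht h (e q) < LongRay.ofOrd ξ} := by
  have hconv : ∀ s : Set ℝ, Convex ℝ s →
      IsPreconnected (s ×ˢ Ici (0 : ℝ) ∩ {z : ℝ × ℝ | z.1 + z.2 < Φ.bound}) := fun s hs =>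
    ((hs.prod (convex_Ici 0)).inter (convex_halfSpace_lt
      (IsLinearMap.isLinearMap_add) Φ.bound)).isPreconnected
  have hκ : IsEmbedding fun q : {q | ht h (e q) < LongRay.ofOrd ξ} =>
      (((Φ.toFun (e q)).1 : ℝ), ((Φ.toFun (e q)).2 : ℝ)) :=
    (IsEmbedding.subtypeVal.prodMap IsEmbedding.subtypeVal).comp
      (Φ.isOpenEmbedding he hsolid).isEmbedding
  rw [isPreconnected_iff_preconnectedSpace, preconnectedSpace_iff_univ,
    ← hκ.isInducing.isPreconnected_image, image_univ]
  have hlt : ∀ q : {q | ht h (e q) < LongRay.ofOrd ξ},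
      ((Φ.toFun (e q)).1 : ℝ) + (Φ.toFun (e q)).2 < Φ.bound :=
    fun q => Φ.add_lt _ (hsolid q) q.2
  rcases hr with hr | hr
  · convert hconv (Ici 0) (convex_Ici 0) using 1
    ext ⟨a, b⟩
    constructor
    · rintro ⟨q, hq⟩
      rw [← hq]
      exact ⟨⟨(Φ.toFun (e q)).1.2, (Φ.toFun (e q)).2.2⟩, hlt q⟩
    · rintro ⟨⟨ha, hb⟩, hab⟩
      obtain ⟨p, hp, hpz⟩ := Φ.exists_eq (⟨a, ha⟩, ⟨b, hb⟩) hab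
      obtain ⟨q, rfl⟩ : p ∈ range e := hr ▸ mem_univ p
      exact ⟨⟨q, hp⟩, by simp [hpz]⟩
  · convert hconv (Ioi 0) (convex_Ioi 0) using 1
    ext ⟨a, b⟩
    constructor
    · rintro ⟨q, hq⟩
      rw [← hq]
      have hq' : e q ∈ (range (side h β))ᶜ := hr ▸ mem_range_self _
      exact ⟨⟨Φ.fst_pos _ hq' q.2, (Φ.toFun (e q)).2.2⟩, hlt q⟩
    · rintro ⟨⟨ha, hb⟩, hab⟩
      obtain ⟨p, hp, hpz⟩ := Φ.exists_eq (⟨a, mem_Ici.2 (le_of_lt ha)⟩, ⟨b, hb⟩) hab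
      obtain ⟨q, rfl⟩ : p ∈ range e := by
        rw [hr]
        rintro ⟨x, rfl⟩
        have h0 := Φ.fst_top x
        rw [hpz] at h0
        exact (mem_Ioi.1 ha).ne' h0
      exact ⟨⟨q, hp⟩, by simp [hpz]⟩

theorem isSurface_of_isSolid (hh : Function.Injective h) [Nonempty X] (he : IsOpenEmbedding e)
    (hsolid : ∀ q, IsSolid h (e q))
    (hr : range e = Set.univ ∨ range e = (range (side h β))ᶜ) : IsSurface X := by
  refine ⟨he.isEmbedding.t2Space, ?_, fun q => ?_⟩
  · have : PreconnectedSpace X := ⟨isPreconnected_of_forall_pair fun p _ q _ => by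
      obtain ⟨a, ha⟩ := LongRay.exists_lt_ofOrd (max (ht h (e p)) (ht h (e q)))
      obtain ⟨Φ⟩ := nonempty_quadrantMap hh a
      refine ⟨{q | ht h (e q) < LongRay.ofOrd a}, subset_univ _, ?_, ?_,
        Φ.isPreconnected he hsolid hr⟩
      · exact lt_of_le_of_lt (le_max_left _ _) ha
      · exact lt_of_le_of_lt (le_max_right _ _) ha⟩
    exact ⟨inferInstance⟩
  · obtain ⟨a, ha⟩ := LongRay.exists_lt_ofOrd (ht h (e q))
    obtain ⟨Φ⟩ := nonempty_quadrantMap hh a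
    exact exists_chart_of_quadrant
      (isOpen_lt ((continuous_ht h).comp he.continuous) continuous_const)
      (Φ.isOpenEmbedding he hsolid) ha

/-- Once the upper side is removed, parts of bounded height need not be compact, but they embed in
the quadrant and so are hereditarily Lindelöf. -/
theorem isLindelof_of_isSolid (hh : Function.Injective h) (he : IsOpenEmbedding e)
    (hsolid : ∀ q, IsSolid h (e q)) (a : OmegaOne) :
    IsLindelof {q | ht h (e q) ≤ LongRay.ofOrd a} := by
  obtain ⟨b, hb⟩ := exists_gt a
  obtain ⟨Φ⟩ := nonempty_quadrantMap hh b
  have : SecondCountableTopology {q | ht h (e q) < LongRay.ofOrd b} :=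
    (Φ.isOpenEmbedding he hsolid).isEmbedding.secondCountableTopology
  have hL := HereditarilyLindelofSpace.isLindelof
    (Subtype.val ⁻¹' {q | ht h (e q) ≤ LongRay.ofOrd a} :
      Set {q | ht h (e q) < LongRay.ofOrd b})
  have := hL.image continuous_subtype_val
  rwa [Subtype.image_preimage_coe, inter_eq_right.2] at this
  intro q hq
  exact (show ht h (e q) ≤ _ from hq).trans_lt (LongRay.ofOrd_lt_ofOrd.2 hb)

end OctantPile

/-! ### The long strip -/

instance : PreconnectedSpace LongRay := ⟨isPreconnected_of_forall_pair fun x _ y _ =>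
  ⟨Icc ⊥ (max x y), subset_univ _, ⟨bot_le, le_max_left _ _⟩, ⟨bot_le, le_max_right _ _⟩,
    isPreconnected_iff_preconnectedSpace.2 (LongRay.preconnectedSpace_Icc bot_le)⟩⟩

namespace LongStrip

theorem isCompact_fst_le (x : LongRay) : IsCompact {p : LongRay × unitInterval | p.1 ≤ x} := by
  have : {p : LongRay × unitInterval | p.1 ≤ x} = Iic x ×ˢ Set.univ := by
    ext p
    simp
  rw [this]
  exact (LongRay.isCompact_Iic x).prod isCompact_univ

theorem range_fst : range (Prod.fst : LongRay × unitInterval → LongRay) = Set.univ :=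
  Prod.fst_surjective.range_eq

theorem not_bddAbove_univ : ¬ BddAbove (Set.univ : Set LongRay) :=
  LongRay.not_bddAbove_iff.2 fun a => by
    obtain ⟨b, hb⟩ := exists_gt (LongRay.ofOrd a)
    exact ⟨b, trivial, hb⟩

theorem isTypeI : IsTypeI (LongRay × unitInterval) :=
  isTypeI_of_height continuous_fst (fun _ => (isCompact_fst_le _).isLindelof)
    (range_fst ▸ not_bddAbove_univ)

theorem isOmegaBounded : IsOmegaBounded (LongRay × unitInterval) := fun A hA => by
  obtain ⟨a, ha⟩ := LongRay.bddAbove_of_countable (hA.image Prod.fst)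
  refine (isCompact_fst_le (LongRay.ofOrd a)).of_isClosed_subset isClosed_closure
    (closure_minimal (fun p hp => (ha _ (mem_image_of_mem _ hp)).le) ?_)
  exact isClosed_le continuous_fst continuous_const

/-- Taking `τ` to be the identity or the flip covers the strip away from one edge or the other. -/
theorem exists_chart_of_lt {τ : unitInterval ≃ₜ unitInterval} {p : LongRay × unitInterval}
    (hp : τ p.2 < 1) : ∃ U : Set (LongRay × unitInterval), IsOpen U ∧ p ∈ U ∧
      (Nonempty (U ≃ₜ ℝ × ℝ) ∨ Nonempty (U ≃ₜ ℝ × Ici (0 : ℝ))) := by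
  obtain ⟨ξ, hξ⟩ := LongRay.exists_lt_ofOrd p.1
  obtain ⟨φ, hφ, -, hstrict, hbd, himg⟩ := LongRay.exists_real_chart ξ
  let V : Set (LongRay × unitInterval) := {p | p.1 < LongRay.ofOrd ξ ∧ τ p.2 < 1}
  have hV : IsOpen V := (isOpen_lt continuous_fst continuous_const).inter
    (isOpen_lt (continuous_subtype_val.comp (τ.continuous.comp continuous_snd)) continuous_const)
  let Φ : LongRay × unitInterval → Ici (0 : ℝ) × Ici (0 : ℝ) := fun p =>
    (⟨φ p.1, (hbd p.1).1⟩, ⟨τ p.2, (τ p.2).2.1⟩)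
  have hΦ : Continuous Φ := (Continuous.subtype_mk (hφ.comp continuous_fst) _).prodMk
    (Continuous.subtype_mk (continuous_subtype_val.comp (τ.continuous.comp continuous_snd)) _)
  let W : Set (Ici (0 : ℝ) × Ici (0 : ℝ)) :=
    {z | (z.1 : ℝ) < φ (LongRay.ofOrd ξ) ∧ (z.2 : ℝ) < 1}
  have hW : IsOpen W :=
    (isOpen_lt (continuous_subtype_val.comp continuous_fst) continuous_const).inter
      (isOpen_lt (continuous_subtype_val.comp continuous_snd) continuous_const)
  have hk : IsOpenEmbedding fun q : V => Φ q := by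
    refine isOpenEmbedding_comp_of_isCompact hΦ hV.isOpenEmbedding_subtypeVal
      (isCompact_fst_le (LongRay.ofOrd ξ)) (fun q => q.2.1.le) hW
      (fun q => ⟨hstrict q.2.1.le self_mem_Iic q.2.1, q.2.2⟩) (fun q p hp hqp => ?_) ?_
    · have h1 : φ q.1.1 = φ p.1 :=
        congrArg (fun z : Ici (0 : ℝ) × Ici (0 : ℝ) => (z.1 : ℝ)) hqp
      have h2 : (τ q.1.2 : ℝ) = τ p.2 :=
        congrArg (fun z : Ici (0 : ℝ) × Ici (0 : ℝ) => (z.2 : ℝ)) hqp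
      exact Prod.ext (hstrict.injOn q.2.1.le hp h1) (τ.injective (Subtype.ext h2))
    · rintro ⟨⟨a, ha⟩, ⟨t, ht⟩⟩ ⟨ha', ht'⟩
      obtain ⟨x, hx, hxa⟩ := himg.symm.subset ⟨ha, le_of_lt ha'⟩
      refine ⟨(x, τ.symm ⟨t, ht, le_of_lt ht'⟩), hx, Prod.ext (Subtype.ext hxa) (Subtype.ext ?_)⟩
      simp [Φ]
  exact exists_chart_of_quadrant hV hk ⟨hξ, hp⟩

theorem isSurface : IsSurface (LongRay × unitInterval) := by
  have : Nonempty LongRay := ⟨⊥⟩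
  have : ConnectedSpace (LongRay × unitInterval) := ⟨inferInstance⟩
  refine ⟨inferInstance, this, fun p => ?_⟩
  rcases (unitInterval.le_one' (t := p.2)).eq_or_lt with h1 | h1
  · refine exists_chart_of_lt (τ := unitInterval.symmHomeomorph) ?_
    simp [h1]
  · exact exists_chart_of_lt (τ := Homeomorph.refl _) h1

theorem isClubSet_iff {C : Set (LongRay × unitInterval)} :
    IsClubSet C ↔ IsClosed C ∧ ¬ BddAbove (Prod.fst '' C) := by
  rw [IsClubSet, isBoundedTypeI_iff continuous_fst fun _ => (isCompact_fst_le _).isLindelof]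

/-- An unbounded function equals the height across the whole strip at club many heights, and a club
set meets club many of these because projection along the compact factor is closed. -/
theorem ufoLE {C D : Set (LongRay × unitInterval)} (hD : IsClubSet D) : UfoLE C D := by
  intro f hf hu
  rw [isClubSet_iff] at hD
  rcases LongRay.bounded_or_eventually_fixed (F := fun (y : unitInterval) x => f (x, y))
    (fun y => by fun_prop) (fun x => by fun_prop) with ⟨k, hk⟩ | hfix
  · exact absurd ⟨k, by rintro _ ⟨p, -, rfl⟩; exact hk p.2 p.1⟩ hu
  · refine OctantPile.not_bddAbove_of_eventually ?_
    filter_upwards [hfix, LongRay.eventually_ofOrd_mem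
      (isClosedMap_fst_of_compactSpace _ hD.1) hD.2] with x hx ⟨p, hp, hpx⟩
    refine ⟨p, hp, ?_⟩
    have := hx p.2
    rwa [← hpx] at this ⊢

theorem nonempty_directionClass_orderIso :
    Nonempty (DirectionClass (LongRay × unitInterval) ≃o (Order.succ (0 : Ordinal.{0})).ToType) := by
  have hD : IsClubSet (Set.univ : Set (LongRay × unitInterval)) :=
    isClubSet_iff.2 ⟨isClosed_univ, by rw [image_univ, range_fst]; exact not_bddAbove_univ⟩
  have : Unique (DirectionClass (LongRay × unitInterval)) :=
    { default := toAntisymmetrization (· ≤ ·) ⟨Set.univ, hD, fun C hC _ => ⟨ufoLE hD, ufoLE hC⟩⟩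
      uniq := fun x => by
        induction x using Antisymmetrization.ind with
        | _ D => exact Quotient.sound ⟨ufoLE hD, ufoLE D.isClubSet⟩ }
  have : Unique (Order.succ (0 : Ordinal.{0})).ToType := by
    rw [Order.succ_eq_add_one, zero_add]
    infer_instance
  exact ⟨OrderIso.ofUnique _ _⟩

end LongStrip

/-! ### Piles and piles without upper side -/

theorem exists_injective_omegaOne {β : Ordinal.{0}} (hβ : β < ω_ (2 : Ordinal.{0})) :
    ∃ h : β.ToType → OmegaOne, Function.Injective h := by
  have h1 : Cardinal.mk β.ToType ≤ Cardinal.mk OmegaOne := by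
    rw [Cardinal.mk_toType, Cardinal.mk_toType, ← Order.lt_succ_iff, Ordinal.card_omega,
      Cardinal.succ_aleph, ← Cardinal.lt_ord, Cardinal.ord_aleph, one_add_one_eq_two]
    exact hβ
  obtain ⟨f⟩ := h1
  exact ⟨f, f.injective⟩

theorem exists_injective_omegaOne_bot {β : Ordinal.{0}} (hβ : β < ω_ (2 : Ordinal.{0}))
    (hβ₀ : β ≠ 0) : ∃ h : β.ToType → OmegaOne, Function.Injective h ∧ ∃ b, ∀ c, h b ≤ c := by
  obtain ⟨h, hh⟩ := exists_injective_omegaOne hβ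
  obtain ⟨b⟩ := nonempty_toType_iff.2 hβ₀
  -- A transposition of `ω₁` moves one value of `h` to `0` and preserves injectivity.
  exact ⟨Equiv.swap (h b) ⊥ ∘ h, (Equiv.injective _).comp hh, b, by simp⟩

namespace OctantPile

variable {β : Ordinal.{0}} {h : β.ToType → OmegaOne}

theorem isTypeI_of_reaches {X : Type} [TopologicalSpace X] {e : X → OctantPile h}
    (he : IsPart h e) {γ : Ordinal.{0}} (hγ : Reaches e γ) : IsTypeI X := by
  refine isTypeI_of_height he.continuous_height he.isLindelof ?_
  obtain ⟨-, h2⟩ := he.isClubSet_iff.1 (he.isClubSet_ray hγ)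
  refine LongRay.not_bddAbove_iff.2 fun a => ?_
  obtain ⟨q, -, hq⟩ := h2 a
  exact ⟨_, mem_range_self q, hq⟩

theorem isPart_id (hh : Function.Injective h) : IsPart h (id : OctantPile h → OctantPile h) where
  injective := hh
  isOpenEmbedding := IsOpenEmbedding.id
  mem_range p _ := ⟨p, rfl⟩
  isLindelof _ := (isCompact_ht_le h _).isLindelof

theorem reaches_id_iff {γ : Ordinal.{0}} : Reaches (id : OctantPile h → OctantPile h) γ ↔ γ ≤ β :=
  ⟨fun hγ => hγ.1, fun hγ => ⟨hγ, ⊥, fun _ _ => ⟨_, rfl⟩⟩⟩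

theorem isTypeI (hh : Function.Injective h) : IsTypeI (OctantPile h) :=
  isTypeI_of_reaches (isPart_id hh) (reaches_id_iff.2 le_rfl)

theorem nonempty_directionClass_orderIso (hh : Function.Injective h) :
    Nonempty (DirectionClass (OctantPile h) ≃o (Order.succ β).ToType) :=
  (isPart_id hh).nonempty_directionClass_orderIso (Or.inl (reaches_id_iff.2 le_rfl))
    fun γ => by rw [reaches_id_iff, Order.lt_succ_iff]

theorem isSurface (hh : Function.Injective h) (hb : ∃ b, ∀ c, h b ≤ c) :
    IsSurface (OctantPile h) := by
  obtain ⟨b, hb⟩ := hb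
  have : Nonempty (OctantPile h) := ⟨side h 0 ⊥⟩
  exact isSurface_of_isSolid hh IsOpenEmbedding.id (fun q => ⟨b, Or.inl (le_bot_iff.1 (hb _))⟩)
    (Or.inl range_id)

namespace WithoutTop

theorem isOpenEmbedding_val : IsOpenEmbedding (Subtype.val : WithoutTop h → OctantPile h) :=
  (isClosed_range_side h β).isOpen_compl.isOpenEmbedding_subtypeVal

theorem isSolid (q : WithoutTop h) : IsSolid h q.1 := by
  obtain ⟨b, hb, -⟩ := exists_crd_lt_of_notMem_top q.2
  exact ⟨b, Or.inr hb⟩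

theorem isPart_val (hh : Function.Injective h) :
    IsPart h (Subtype.val : WithoutTop h → OctantPile h) where
  injective := hh
  isOpenEmbedding := isOpenEmbedding_val
  mem_range p hp := ⟨⟨p, hp⟩, rfl⟩
  isLindelof := isLindelof_of_isSolid hh isOpenEmbedding_val isSolid

theorem reaches_val_iff (hh : Function.Injective h) {γ : Ordinal.{0}} :
    Reaches (Subtype.val : WithoutTop h → OctantPile h) γ ↔ γ < β := by
  constructor
  · rintro ⟨hγ, a, ha⟩
    refine lt_of_le_of_ne hγ ?_
    rintro rfl
    obtain ⟨q, hq⟩ := ha _ le_rfl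
    exact q.2 ⟨_, hq.symm⟩
  · intro hγ
    obtain ⟨b, rfl⟩ : ∃ b : β.ToType, (b : Ordinal) = γ := ⟨ToType.mk ⟨γ, hγ⟩, by simp⟩
    exact (isPart_val hh).reaches_coe b

theorem isTypeI (hh : Function.Injective h) (hβ : β ≠ 0) : IsTypeI (WithoutTop h) :=
  isTypeI_of_reaches (isPart_val hh) ((reaches_val_iff hh).2 (pos_iff_ne_zero.2 hβ))

theorem nonempty_directionClass_orderIso (hh : Function.Injective h) (hβ : Order.IsSuccLimit β) :
    Nonempty (DirectionClass (WithoutTop h) ≃o β.ToType) :=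
  (isPart_val hh).nonempty_directionClass_orderIso
    (Or.inr ⟨fun b => by
      have hb : (b : Ordinal) < β := (ToType.mk.symm b).2
      refine ⟨ToType.mk ⟨Order.succ (b : Ordinal), hβ.succ_lt hb⟩, ?_⟩
      rw [← coe_lt_coe]
      simp, fun q => q.2⟩)
    fun γ => reaches_val_iff hh

theorem isSurface (hh : Function.Injective h) (hβ : β ≠ 0) : IsSurface (WithoutTop h) := by
  obtain ⟨b⟩ := nonempty_toType_iff.2 hβ
  obtain ⟨x, hx⟩ := exists_gt (LongRay.ofOrd (h b))
  have : Nonempty (WithoutTop h) := ⟨⟨_, side_notMem_top hx⟩⟩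
  refine isSurface_of_isSolid hh isOpenEmbedding_val isSolid (Or.inr ?_)
  rw [Subtype.range_coe_subtype]
  rfl

end WithoutTop

end OctantPile

theorem mainTheorem5 (α : Ordinal.{0}) (hα₀ : 0 < α) (hα₂ : α < ω_ (2 : Ordinal.{0})) :
    -- there is a surface whose poset of classes of directions is `α`, `ω`-bounded for `α` successor
    (∃ (S : Type) (_ : TopologicalSpace S), IsSurface S ∧ IsTypeI S ∧
      Nonempty (DirectionClass S ≃o α.ToType) ∧
      (∀ β : Ordinal.{0}, α = Order.succ β → IsOmegaBounded S)) ∧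
    -- for a successor `α = β + 1` the pile of octants given by any injective `h : β → ω₁` has these
    -- properties, being two-dimensional everywhere as soon as `h` takes the value `0`
    (∀ β : Ordinal.{0}, α = Order.succ β →
      (β ≠ 0 → ∃ h : β.ToType → (ω_ (1 : Ordinal.{0})).ToType,
        Function.Injective h ∧ ∃ b, ∀ c, h b ≤ c) ∧
      ∀ h : β.ToType → (ω_ (1 : Ordinal.{0})).ToType, Function.Injective h →
        IsTypeI (OctantPile h) ∧ IsOmegaBounded (OctantPile h) ∧
        Nonempty (DirectionClass (OctantPile h) ≃o α.ToType) ∧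
        ((∃ b, ∀ c, h b ≤ c) → IsSurface (OctantPile h))) ∧
    -- for a limit `α` the same holds, after removal of the upper side, for any injective `h : α → ω₁`
    (Order.IsSuccLimit α →
      (∃ h : α.ToType → (ω_ (1 : Ordinal.{0})).ToType, Function.Injective h) ∧
      ∀ h : α.ToType → (ω_ (1 : Ordinal.{0})).ToType, Function.Injective h →
        IsSurface (OctantPile.WithoutTop h) ∧ IsTypeI (OctantPile.WithoutTop h) ∧
        Nonempty (DirectionClass (OctantPile.WithoutTop h) ≃o α.ToType)) := by
  refine ⟨?_, ?_, fun hα => ⟨exists_injective_omegaOne hα₂, fun h hh =>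
    ⟨OctantPile.WithoutTop.isSurface hh hα₀.ne', OctantPile.WithoutTop.isTypeI hh hα₀.ne',
      OctantPile.WithoutTop.nonempty_directionClass_orderIso hh hα⟩⟩⟩
  · rcases Ordinal.zero_or_succ_or_isSuccLimit α with rfl | ⟨β, rfl⟩ | hα
    · exact absurd hα₀ (lt_irrefl _)
    -- The empty pile is a long ray, which is one-dimensional; the long strip replaces it.
    · by_cases hβ : β = 0
      · subst hβ
        exact ⟨_, _, LongStrip.isSurface, LongStrip.isTypeI,
          LongStrip.nonempty_directionClass_orderIso, fun _ _ => LongStrip.isOmegaBounded⟩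
      · obtain ⟨h, hh, hb⟩ := exists_injective_omegaOne_bot ((Order.lt_succ β).trans hα₂) hβ
        exact ⟨_, _, OctantPile.isSurface hh hb, OctantPile.isTypeI hh,
          OctantPile.nonempty_directionClass_orderIso hh, fun _ _ => OctantPile.isOmegaBounded h⟩
    · obtain ⟨h, hh⟩ := exists_injective_omegaOne hα₂
      exact ⟨_, _, OctantPile.WithoutTop.isSurface hh hα₀.ne',
        OctantPile.WithoutTop.isTypeI hh hα₀.ne',
        OctantPile.WithoutTop.nonempty_directionClass_orderIso hh hα,
        fun β hβ => absurd hα (hβ ▸ Order.not_isSuccLimit_succ β)⟩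
  · rintro β rfl
    exact ⟨exists_injective_omegaOne_bot ((Order.lt_succ β).trans hα₂), fun h hh =>
      ⟨OctantPile.isTypeI hh, OctantPile.isOmegaBounded h,
        OctantPile.nonempty_directionClass_orderIso hh, OctantPile.isSurface hh⟩⟩

end
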